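/- Let $N\ge 3$ be an integer, $0\le\mu\le (N-2)^2/8$, $2^*=\frac{2N}{N-2}$, $p=2^*-1$, $\beta=\frac{N-2}{4}=\frac1{p-1}$ and $K(y)=e^{|y|^2/4}$ on $\mathbb R^N$. Let $L^2_K$ be the space $L^2(\mathbb R^N, K\,dy)$ with inner product $(u,w)_K=\int uw\,K\,dy$ (also for vector fields and for the pairing of functions whose product is integrable against $K\,dy$), and let $X\subset L^2_K$ be the completion of $C_c^\infty(\mathbb R^N)$ in the norm $\|\nabla v\|_{K,2}=\left(\int_{\mathbb R^N}|\nabla v|^2K\,dy\right)^{1/2}$. For $v\in X$ put $$A(v)=\int_{\mathbb R^N}\Big(|\nabla v|^2-\mu\frac{|v|^2}{|y|^2}-\beta|v|^2\Big)K\,dy,\qquad B(v)=\int_{\mathbb R^N}|v|^{2^*}K\,dy,$$ $$E_K(v)=\tfrac12A(v)-\tfrac1{2^*}B(v),\qquad D_K(v)=A(v)-B(v),$$ and $$\mathcal N=\{v\in X: D_K(v)=0,\ v\ne0\},\qquad d=\inf_{v\in\mathcal N}E_K(v),\qquad W=\{v\in X: D_K(v)>0,\ E_K(v)<d\}\cup\{0\}.$$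 Consider the problem $$v_s-\Delta v-\tfrac12\,y\cdot\nabla v=\beta v+\frac{\mu v}{|y|^2}+|v|^{p-1}v\ \text{ in }\mathbb R^N\times(0,\infty),\qquad v|_{s=0}=v_0 .\tag{2.1}$$ A global weak solution of (2.1) is a function $v:[0,\infty)\to X$ with $v\in L^\infty(0,\infty;X)$, $v_s\in L^2(0,\infty;L^2_K)$, $v(0)=v_0$ (where $v$ is the representative that is continuous in time with values in $L^2_K$), such that for all $w\in X$ and all $s>0$ $$\int_0^s\big[(v_\tau,w)_K+(\nabla v,\nabla w)_K\big]\,d\tau=\int_0^s\Big(|v|^{p-1}v+\mu\frac{v}{|y|^2}+\beta v,\;w\Big)_K\,d\tau .$$ **Theorem (global existence at low energy).** If $v_0\in X$, $E_K(v_0)<d$ and $D_K(v_0)>0$, then problem (2.1) has a global weak solution $v\in L^\infty(0,\infty;X)$ with $v(s)\in W$ for all $0\le s<\infty$. -/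

import Mathlib

namespace HardyHeat

open MeasureTheory Set
open scoped ENNReal ContDiff

noncomputable section

/-- `ℝ^N` with its Euclidean norm. -/
abbrev Sp (N : ℕ) : Type := EuclideanSpace ℝ (Fin N)

/-- The weight `K(y) = exp (|y|² / 4)`. -/
def weight (N : ℕ) (y : Sp N) : ℝ := Real.exp (‖y‖ ^ 2 / 4)

/-- The measure `K(y) dy`. -/
def measK (N : ℕ) : Measure (Sp N) :=
  volume.withDensity fun y => ENNReal.ofReal (weight N y)

/-- The space `L²_K(ℝ^N)`. -/
abbrev L2K (N : ℕ) : Type := Lp ℝ 2 (measK N)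

/-- The space of vector fields `L²_K(ℝ^N; ℝ^N)`. -/
abbrev L2Kvec (N : ℕ) : Type := Lp (Sp N) 2 (measK N)

/-- The pairs `(φ, ∇φ)` with `φ ∈ C_c^∞(ℝ^N)`, as a linear subspace of
`L²_K(ℝ^N) × L²_K(ℝ^N; ℝ^N)`. -/
def testGraph (N : ℕ) : Submodule ℝ (WithLp 2 (L2K N × L2Kvec N)) where
  carrier := {p | ∃ φ : Sp N → ℝ, ContDiff ℝ ∞ φ ∧ HasCompactSupport φ ∧
    p.fst =ᵐ[measK N] φ ∧ p.snd =ᵐ[measK N] gradient φ}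
  zero_mem' := by
    refine ⟨0, contDiff_const, HasCompactSupport.zero, Lp.coeFn_zero _ _ _, ?_⟩
    have h : gradient (0 : Sp N → ℝ) = 0 := by
      funext y
      simp [gradient]
    rw [h]
    exact Lp.coeFn_zero _ _ _
  add_mem' := by
    rintro p q ⟨φ, hφ, hφc, hp1, hp2⟩ ⟨ψ, hψ, hψc, hq1, hq2⟩
    refine ⟨φ + ψ, hφ.add hψ, hφc.add hψc, ?_, ?_⟩
    · exact (Lp.coeFn_add p.fst q.fst).trans (hp1.add hq1)
    · have h : gradient (φ + ψ) = gradient φ + gradient ψ := by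
        funext y
        have h1 : DifferentiableAt ℝ φ y := (hφ.differentiable (by simp)) y
        have h2 : DifferentiableAt ℝ ψ y := (hψ.differentiable (by simp)) y
        simp [gradient, fderiv_add h1 h2]
      rw [h]
      exact (Lp.coeFn_add p.snd q.snd).trans (hp2.add hq2)
  smul_mem' := by
    rintro c p ⟨φ, hφ, hφc, hp1, hp2⟩
    refine ⟨c • φ, contDiff_const.smul hφ, hφc.smul_left (f := fun _ => c), ?_, ?_⟩
    · exact (Lp.coeFn_smul c p.fst).trans (hp1.const_smul c)
    · have h : gradient (c • φ) = c • gradient φ := by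
        funext y
        have h1 : DifferentiableAt ℝ φ y := (hφ.differentiable (by simp)) y
        simp [gradient, fderiv_const_smul h1 c]
      rw [h]
      exact (Lp.coeFn_smul c p.snd).trans (hp2.const_smul c)

/-- The space `X`, the completion of `C_c^∞(ℝ^N)` for the norm `‖∇v‖_{K,2}`, realized as a space
of functions: because of the weighted Poincaré inequality
`(N / 2) ‖φ‖²_{K,2} ≤ ‖∇φ‖²_{K,2}`, a sequence of test functions that is Cauchy for
`‖∇ ·‖_{K,2}` is Cauchy in `L²_K` as well, so that the completion is the closure of the pairs
`(φ, ∇φ)` in `L²_K(ℝ^N) × L²_K(ℝ^N; ℝ^N)`. -/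
abbrev X (N : ℕ) : Type := (testGraph N).topologicalClosure

/-- The function underlying an element of `X`. -/
def X.fn {N : ℕ} (v : X N) : L2K N := v.1.fst

/-- The gradient `∇v` of an element of `X`. -/
def X.grad {N : ℕ} (v : X N) : L2Kvec N := v.1.snd

/-- The critical Sobolev exponent `2^* = 2N / (N - 2)`. -/
def critExp (N : ℕ) : ℝ := 2 * (N : ℝ) / ((N : ℝ) - 2)

/-- The exponent `p = 2^* - 1`. -/
def expP (N : ℕ) : ℝ := critExp N - 1

/-- The coefficient `β = (N - 2) / 4 = 1 / (p - 1)`. -/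
def beta (N : ℕ) : ℝ := ((N : ℝ) - 2) / 4

/-- `A(v) = ∫ (|∇v|² - μ |v|² / |y|² - β |v|²) K dy`. -/
def funA (N : ℕ) (μ : ℝ) (v : X N) : ℝ :=
  ∫ y, (‖v.grad y‖ ^ 2 - μ * (|v.fn y| ^ 2 / ‖y‖ ^ 2) - beta N * |v.fn y| ^ 2) ∂measK N

/-- `B(v) = ∫ |v|^{2^*} K dy`. -/
def funB (N : ℕ) (v : X N) : ℝ := ∫ y, |v.fn y| ^ critExp N ∂measK N

/-- The energy `E_K(v) = A(v) / 2 - B(v) / 2^*`. -/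
def energy (N : ℕ) (μ : ℝ) (v : X N) : ℝ := 1 / 2 * funA N μ v - 1 / critExp N * funB N v

/-- The functional `D_K(v) = A(v) - B(v)`. -/
def funD (N : ℕ) (μ : ℝ) (v : X N) : ℝ := funA N μ v - funB N v

/-- The Nehari manifold. -/
def nehari (N : ℕ) (μ : ℝ) : Set (X N) := {v | funD N μ v = 0 ∧ v ≠ 0}

/-- The depth `d = inf_{v ∈ 𝒩} E_K(v)` of the potential well. -/
def depth (N : ℕ) (μ : ℝ) : ℝ := sInf (energy N μ '' nehari N μ)

/-- The potential well `W`. -/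
def well (N : ℕ) (μ : ℝ) : Set (X N) :=
  {v | 0 < funD N μ v ∧ energy N μ v < depth N μ} ∪ {0}

/-- The time interval `(0, S)`, where `S = ⊤` is allowed. -/
def timeInterval (S : EReal) : Set ℝ := {s | 0 < s ∧ (s : EReal) < S}

/-- `v ∈ L^∞(0, S; X)`: strong measurability with values in `X` and an essential bound for the
norm `‖∇v(s)‖_{K,2}` of `X`. -/
def MemLinftyX {N : ℕ} (S : EReal) (v : ℝ → X N) : Prop :=
  AEStronglyMeasurable v (volume.restrict (timeInterval S)) ∧
    ∃ C : ℝ, ∀ᵐ s ∂volume.restrict (timeInterval S), ‖(v s).grad‖ ≤ C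

/-- `g = v_s ∈ L²(0, S; L²_K)` is the time derivative of `v`, where `v` is the representative that
is continuous in time with values in `L²_K`: `v(s) = v(0) + ∫_0^s g dτ` for all `0 ≤ s < S`. -/
def IsTimeDeriv {N : ℕ} (S : EReal) (v : ℝ → X N) (g : ℝ → L2K N) : Prop :=
  MemLp g 2 (volume.restrict (timeInterval S)) ∧
    ∀ s : ℝ, 0 ≤ s → (s : EReal) < S → (v s).fn = (v 0).fn + ∫ τ in (0 : ℝ)..s, g τ

/-- The pairing `(|v|^{p-1} v + μ v / |y|² + β v, w)_K` of the right-hand side with `w ∈ X`. -/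
def rhsPairing (N : ℕ) (μ : ℝ) (v w : X N) : ℝ :=
  ∫ y, (|v.fn y| ^ (expP N - 1) * v.fn y + μ * (v.fn y / ‖y‖ ^ 2) + beta N * v.fn y) * w.fn y
    ∂measK N

/-- `v` is a weak solution on `ℝ^N × (0, S)` of
`v_s - Δv - y · ∇v / 2 = β v + μ v / |y|² + |v|^{p-1} v`, `v(0) = v₀`. -/
def IsWeakSolution (N : ℕ) (μ : ℝ) (S : EReal) (v₀ : X N) (v : ℝ → X N) : Prop :=
  MemLinftyX S v ∧ v 0 = v₀ ∧
    ∃ g : ℝ → L2K N, IsTimeDeriv S v g ∧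
      ∀ w : X N, ∀ s : ℝ, 0 < s → (s : EReal) < S →
        ∫ τ in (0 : ℝ)..s, (inner ℝ (g τ) w.fn + inner ℝ (v τ).grad w.grad) =
          ∫ τ in (0 : ℝ)..s, rhsPairing N μ (v τ) w

end

end HardyHeat

namespace HardyHeat

open MeasureTheory Set Filter Topology
open scoped ENNReal NNReal ContDiff

noncomputable section

variable {N : ℕ}

/-! The solution is built by implicit Euler steps (minimizing movements) confined to a sublevel set
of `A`. Two facts make this work at the critical exponent. Since `1/2 - 1/2^* = 1/N`, one has `E =
A/N + D/2^*` (`energy_eq`). If `v ≠ 0` and `D(v) ≤ 0`, shrinking `v` onto the Nehari manifold gives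
`A(v) ≥ N d` (`depth_le_formA`). Hence `A < N d` forces `D ≥ 0`, then `E ≥ 0` and `A ≤ N E`. The
bound on `μ` and the weighted Hardy and Poincaré inequalities make `A` coercive on `X`
(`formA_coercive`), so these are bounds in `X`.

The embedding of `X` into `L^{2^*}_K` need not be compact, so `B` need not be weakly continuous. A
one-sided Brezis–Lieb estimate yields, for `u_n ⇀ v`, `E(u_n) ≥ E(v) + E(u_n - v) - o(1)`; when
`A(u_n) ≤ R < N d`, the remainder eventually satisfies `A(u_n - v) < N d` and so has nonnegative
energy. Thus `E` is weakly lower semicontinuous there (`weak_lsc`), and each Euler step has a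
minimizer under the constraint `A ≤ R`. Its energy is at most `e = E(v₀) < d`, so `A ≤ N e < R`: the
constraint is inactive and the Euler–Lagrange equation holds (`exists_step`).

The telescoped energy inequality bounds the difference quotients in `L²(0,∞; L²_K)`. A weak limit of
these determines, through its primitive, the weak limit in `X` of the step functions at every time
(`exists_limit`). The compact embedding of `X` into `L²_K` (`tendsto_fn_of_weakTendsto`) gives a.e.
convergence along subsequences, which is enough for the nonlinear pairing (`tendsto_nlPairing`);
lower semicontinuity keeps the limit in `W`. -/

/-! ### The Gaussian weight and the weighted Dirichlet integral. -/

lemma weight_pos (y : Sp N) : 0 < weight N y := Real.exp_pos _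

lemma one_le_weight (y : Sp N) : 1 ≤ weight N y := Real.one_le_exp (by positivity)

lemma contDiff_weight {n : WithTop ℕ∞} : ContDiff ℝ n (weight N) :=
  Real.contDiff_exp.comp ((contDiff_norm_sq ℝ).div_const 4)

lemma continuous_weight : Continuous (weight N) := (contDiff_weight (n := 0)).continuous

lemma fderiv_weight_self (y : Sp N) :
    fderiv ℝ (weight N) y y = weight N y * (‖y‖ ^ 2 / 2) := by
  have h1 : HasFDerivAt (fun y : Sp N => ‖y‖ ^ 2) (2 • (innerSL ℝ y)) y :=
    (hasStrictFDerivAt_norm_sq y).hasFDerivAt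
  have h2 : HasFDerivAt (weight N) _ y := (h1.mul_const (1/4 : ℝ)).exp.congr_of_eventuallyEq
    (Eventually.of_forall fun z => by simp [weight, div_eq_mul_inv])
  rw [h2.fderiv]
  simp [weight, div_eq_mul_inv]
  ring

lemma measurable_ofReal_weight : Measurable fun y => ENNReal.ofReal (weight N y) :=
  continuous_weight.measurable.ennreal_ofReal

instance : IsLocallyFiniteMeasure (measK N) :=
  IsLocallyFiniteMeasure.withDensity_ofReal continuous_weight

lemma volume_le_measK : (volume : Measure (Sp N)) ≤ measK N := by
  have h : (volume : Measure (Sp N)) = volume.withDensity 1 := (withDensity_one).symm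
  rw [h, measK]
  refine withDensity_mono (Eventually.of_forall fun y => ?_)
  simpa using one_le_weight y

lemma volume_absolutelyContinuous_measK : (volume : Measure (Sp N)) ≪ measK N :=
  volume_le_measK.absolutelyContinuous

lemma measK_absolutelyContinuous : measK N ≪ (volume : Measure (Sp N)) :=
  withDensity_absolutelyContinuous _ _

lemma integral_measK (f : Sp N → ℝ) : ∫ y, f y ∂measK N = ∫ y, weight N y * f y := by
  rw [measK, integral_withDensity_eq_integral_toReal_smul measurable_ofReal_weight
    (by simp)]
  simp [ENNReal.toReal_ofReal (weight_pos _).le]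

/-- The integral of the divergence of `y ↦ f y • y` vanishes. -/
lemma integral_divergence_smul_id {f : Sp N → ℝ} (hf : ContDiff ℝ 1 f)
    (hfc : HasCompactSupport f) :
    ∫ y, (N * f y + fderiv ℝ f y y) = 0 := by
  let b := EuclideanSpace.basisFun (Fin N) ℝ
  have hf0 : Continuous f := hf.continuous
  have h_int : Integrable f := hf0.integrable_of_hasCompactSupport hfc
  have hd (v : Sp N) : Continuous fun y => fderiv ℝ f y v :=
    (hf.continuous_fderiv one_ne_zero).clm_apply continuous_const
  have hdc (v : Sp N) : HasCompactSupport fun y => fderiv ℝ f y v :=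
    hfc.fderiv_apply (𝕜 := ℝ) v
  have hi (i : Fin N) : Integrable fun y : Sp N => fderiv ℝ f y (b i) * y i :=
    ((hd (b i)).mul (by fun_prop)).integrable_of_hasCompactSupport ((hdc (b i)).mul_right)
  have hg (i : Fin N) (y : Sp N) : fderiv ℝ (fun y : Sp N => y i) y (b i) = 1 := by
    have : HasFDerivAt (fun y : Sp N => y i) (EuclideanSpace.proj i : Sp N →L[ℝ] ℝ) y :=
      (EuclideanSpace.proj i : Sp N →L[ℝ] ℝ).hasFDerivAt
    rw [this.fderiv]
    simp [b]
  have key (i : Fin N) : ∫ y, f y = - ∫ y : Sp N, fderiv ℝ f y (b i) * y i := by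
    have := integral_mul_fderiv_eq_neg_fderiv_mul_of_integrable (μ := (volume : Measure (Sp N)))
      (f := f) (g := fun y : Sp N => y i) (v := b i) (hi i) (by simpa [hg] using h_int)
      ((hf0.mul (by fun_prop)).integrable_of_hasCompactSupport hfc.mul_right)
      (fun y _ => hf.differentiable one_ne_zero y)
      (fun y _ => (EuclideanSpace.proj i : Sp N →L[ℝ] ℝ).differentiable y)
    simpa [hg] using this
  have hsum (y : Sp N) : fderiv ℝ f y y = ∑ i, fderiv ℝ f y (b i) * y i := by
    have h := congrArg (fderiv ℝ f y) (b.sum_repr y)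
    rw [map_sum] at h
    rw [← h]
    simp [b, mul_comm]
  have h3 : ∫ y, fderiv ℝ f y y = ∑ i : Fin N, ∫ y : Sp N, fderiv ℝ f y (b i) * y i := by
    rw [← integral_finsetSum _ fun i _ => hi i]
    simp_rw [hsum]
  rw [integral_add (h_int.const_mul _), h3, integral_const_mul]
  · have : ∑ i : Fin N, ∫ y : Sp N, fderiv ℝ f y (b i) * y i = ∑ i : Fin N, - ∫ y, f y :=
      Finset.sum_congr rfl fun i _ => by rw [key i, neg_neg]
    rw [this]
    simp
  · simp_rw [hsum]
    exact integrable_finsetSum _ fun i _ => hi i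

lemma inner_gradient_eq (φ : Sp N → ℝ) (y z : Sp N) :
    inner ℝ (gradient φ y) z = fderiv ℝ φ y z := by
  simp [gradient, InnerProductSpace.toDual_symm_apply]

lemma continuous_gradient {φ : Sp N → ℝ} (hφ : ContDiff ℝ 1 φ) : Continuous (gradient φ) :=
  (InnerProductSpace.toDual ℝ (Sp N)).symm.continuous.comp (hφ.continuous_fderiv one_ne_zero)

lemma hasCompactSupport_gradient {φ : Sp N → ℝ} (hφ : HasCompactSupport φ) :
    HasCompactSupport (gradient φ) :=
  (hφ.fderiv (𝕜 := ℝ)).comp_left (g := (InnerProductSpace.toDual ℝ (Sp N)).symm) (map_zero _)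

lemma norm_gradient (φ : Sp N → ℝ) (y : Sp N) : ‖gradient φ y‖ = ‖fderiv ℝ φ y‖ :=
  LinearIsometryEquiv.norm_map _ _

/-- Completing the square in the weighted Dirichlet integral. -/
lemma integral_norm_gradient_add_sq {φ c : Sp N → ℝ} (hφ : ContDiff ℝ 1 φ)
    (hφc : HasCompactSupport φ) (hc : ContDiff ℝ 1 c) :
    ∫ y, ‖gradient φ y + (φ y * c y) • y‖ ^ 2 ∂measK N =
      ∫ y, ‖gradient φ y‖ ^ 2 ∂measK N - ∫ y, φ y ^ 2 * (N * c y + fderiv ℝ c y y +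
        c y * ‖y‖ ^ 2 / 2 - c y ^ 2 * ‖y‖ ^ 2) ∂measK N := by
  have hφ0 := hφ.continuous
  have hc0 := hc.continuous
  have hg := continuous_gradient hφ
  have hgc := hasCompactSupport_gradient hφc
  have hdc : Continuous fun y => fderiv ℝ c y y :=
    (hc.continuous_fderiv one_ne_zero).clm_apply continuous_id
  have hdφ : Continuous fun y => fderiv ℝ φ y y :=
    (hφ.continuous_fderiv one_ne_zero).clm_apply continuous_id
  have hw := continuous_weight (N := N)
  have hφ2 : HasCompactSupport fun y => φ y ^ 2 := hφc.comp_left (g := fun t => t ^ 2) (by simp)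
  -- The field `φ² c K y` has integral zero divergence; this trades the cross term `2 c φ y·∇φ` for
  -- a potential. The summand `c |y|²/2` comes from `y·∇K = K |y|²/2`.
  have hK : ContDiff ℝ 1 fun y => φ y ^ 2 * c y * weight N y :=
    ((hφ.pow 2).mul hc).mul contDiff_weight
  have hdiv := integral_divergence_smul_id hK (hφ2.mul_right.mul_right)
  have hfd (y : Sp N) : fderiv ℝ (fun y => φ y ^ 2 * c y * weight N y) y y =
      weight N y * (2 * φ y * c y * fderiv ℝ φ y y + φ y ^ 2 * fderiv ℝ c y y +
        φ y ^ 2 * c y * (‖y‖ ^ 2 / 2)) := by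
    have h1 := (hφ.differentiable one_ne_zero y).hasFDerivAt
    have h2 := (hc.differentiable one_ne_zero y).hasFDerivAt
    have h3 := ((contDiff_weight (N := N) (n := 1)).differentiable one_ne_zero y).hasFDerivAt
    have h := (((h1.pow 2).mul h2).mul h3).fderiv
    have e : (fun y => φ y ^ 2 * c y * weight N y) =
        (fun x => φ x ^ 2) * c * weight N := rfl
    rw [e, h]
    simp [fderiv_weight_self]
    ring
  have I1 : Integrable (fun y => ‖gradient φ y‖ ^ 2) (measK N) :=
    (by fun_prop : Continuous fun y => ‖gradient φ y‖ ^ 2).integrable_of_hasCompactSupport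
      (hgc.comp_left (g := fun t => ‖t‖ ^ 2) (by simp))
  have I2 : Integrable (fun y => φ y ^ 2 * (N * c y + fderiv ℝ c y y +
        c y * ‖y‖ ^ 2 / 2 - c y ^ 2 * ‖y‖ ^ 2)) (measK N) := by
    have : Continuous fun y => φ y ^ 2 * (N * c y + fderiv ℝ c y y +
        c y * ‖y‖ ^ 2 / 2 - c y ^ 2 * ‖y‖ ^ 2) := by fun_prop
    exact this.integrable_of_hasCompactSupport hφ2.mul_right
  rw [← integral_sub I1 I2]
  have I3 : Integrable (fun y => ‖gradient φ y + (φ y * c y) • y‖ ^ 2) (measK N) := by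
    have : Continuous fun y => ‖gradient φ y + (φ y * c y) • y‖ ^ 2 := by fun_prop
    refine this.integrable_of_hasCompactSupport ?_
    have hs : HasCompactSupport fun y : Sp N => (φ y * c y) • y :=
      hφc.mul_right.smul_right (f' := fun y : Sp N => y)
    have ha : HasCompactSupport fun y => gradient φ y + (φ y * c y) • y := hgc.add hs
    exact ha.comp_left (g := fun t => ‖t‖ ^ 2) (by simp)
  have hsub := integral_sub I3 (I1.sub I2)
  simp only [Pi.sub_apply] at hsub
  rw [← sub_eq_zero, ← hsub, integral_measK, ← hdiv]
  congr 1
  funext y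
  rw [hfd, norm_add_sq_real, inner_smul_right, inner_gradient_eq, norm_smul, mul_pow,
    Real.norm_eq_abs, sq_abs]
  ring

lemma eLpNorm_two_le_of_integral_sq_le {α β E F : Type*} [MeasurableSpace α] [MeasurableSpace β]
    [NormedAddCommGroup E] [NormedAddCommGroup F] {μ : Measure α} {ν : Measure β} {f : α → E}
    {g : β → F} {c : ℝ≥0} (hf : MemLp f 2 μ) (hg : MemLp g 2 ν)
    (h : ∫ x, ‖f x‖ ^ 2 ∂μ ≤ c ^ 2 * ∫ x, ‖g x‖ ^ 2 ∂ν) :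
    eLpNorm f 2 μ ≤ c * eLpNorm g 2 ν := by
  rw [hf.eLpNorm_eq_integral_rpow_norm (by simp) (by simp),
    hg.eLpNorm_eq_integral_rpow_norm (by simp) (by simp),
    ENNReal.ofReal_eq_coe_nnreal (by positivity), ENNReal.ofReal_eq_coe_nnreal (by positivity)]
  norm_cast
  rw [← NNReal.coe_le_coe]
  simp only [NNReal.coe_mul, NNReal.coe_mk]
  rw [show (2 : ℝ)⁻¹ = 1 / 2 by norm_num, ← Real.sqrt_eq_rpow, ← Real.sqrt_eq_rpow]
  refine (Real.sqrt_le_sqrt h).trans_eq ?_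
  rw [Real.sqrt_mul (by positivity), Real.sqrt_sq c.coe_nonneg]

/-! ### Weighted Poincaré, moment, Hardy and Sobolev inequalities for test functions. -/

section Test

variable {φ : Sp N → ℝ}

lemma memLp_gradient (hφ : ContDiff ℝ 1 φ) (hφc : HasCompactSupport φ) :
    MemLp (gradient φ) 2 (measK N) :=
  (continuous_gradient hφ).memLp_of_hasCompactSupport (hasCompactSupport_gradient hφc)

/-- The choice `c = 1/2` makes the `|y|²` terms cancel and leaves the constant potential `N/2`. -/
lemma poincare_test (hφ : ContDiff ℝ 1 φ) (hφc : HasCompactSupport φ) :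
    N / 2 * ∫ y, φ y ^ 2 ∂measK N ≤ ∫ y, ‖gradient φ y‖ ^ 2 ∂measK N := by
  have h := integral_norm_gradient_add_sq hφ hφc (contDiff_const (c := (1 / 2 : ℝ)))
  have h0 : 0 ≤ ∫ y, ‖gradient φ y + (φ y * (1 / 2)) • y‖ ^ 2 ∂measK N :=
    integral_nonneg fun y => by positivity
  rw [h, sub_nonneg] at h0
  refine le_trans (le_of_eq ?_) h0
  rw [← integral_const_mul]
  congr 1
  funext y
  simp
  ring

/-- The value `c = 1/4` maximizes the `|y|²` coefficient `c/2 - c²`, which controls tails at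
infinity. It is also the field that appears in `∇(K^{1/2} φ) = K^{1/2} (∇φ + φ y/4)`, used for
Sobolev. -/
lemma integral_norm_gradient_add_quarter_sq (hφ : ContDiff ℝ 1 φ) (hφc : HasCompactSupport φ) :
    ∫ y, ‖gradient φ y + (φ y * (1 / 4)) • y‖ ^ 2 ∂measK N =
      ∫ y, ‖gradient φ y‖ ^ 2 ∂measK N -
        ∫ y, φ y ^ 2 * (N / 4 + ‖y‖ ^ 2 / 16) ∂measK N := by
  rw [integral_norm_gradient_add_sq hφ hφc (contDiff_const (c := (1 / 4 : ℝ)))]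
  congr 2
  funext y
  rw [fderiv_const_apply]
  simp only [zero_apply]
  ring

lemma norm_mul_test (hφ : ContDiff ℝ 1 φ) (hφc : HasCompactSupport φ) :
    eLpNorm (fun y => ‖y‖ * φ y) 2 (measK N) ≤ (4 : ℝ≥0) * eLpNorm (gradient φ) 2 (measK N) := by
  have hφ0 := hφ.continuous
  have hcs : HasCompactSupport fun y => φ y ^ 2 := hφc.comp_left (g := fun t => t ^ 2) (by simp)
  refine eLpNorm_two_le_of_integral_sq_le
    ((by fun_prop : Continuous fun y : Sp N => ‖y‖ * φ y).memLp_of_hasCompactSupport hφc.mul_left)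
    (memLp_gradient hφ hφc) ?_
  have h := integral_norm_gradient_add_quarter_sq hφ hφc
  have h0 : 0 ≤ ∫ y, ‖gradient φ y + (φ y * (1 / 4)) • y‖ ^ 2 ∂measK N :=
    integral_nonneg fun y => by positivity
  rw [h, sub_nonneg] at h0
  have h1 : ∫ y, ‖‖y‖ * φ y‖ ^ 2 ∂measK N ≤
      16 * ∫ y, φ y ^ 2 * (N / 4 + ‖y‖ ^ 2 / 16) ∂measK N := by
    rw [← integral_const_mul]
    refine integral_mono_of_nonneg (Eventually.of_forall fun y => by positivity) ?_
      (Eventually.of_forall fun y => ?_)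
    · have : Continuous fun y : Sp N => φ y ^ 2 * ((N : ℝ) / 4 + ‖y‖ ^ 2 / 16) := by fun_prop
      exact (this.integrable_of_hasCompactSupport hcs.mul_right).const_mul _
    · simp only [norm_mul, mul_pow, Real.norm_eq_abs, sq_abs]
      have : 0 ≤ φ y ^ 2 * N := by positivity
      nlinarith
  refine h1.trans ?_
  norm_num
  exact h0

/-- Complete the square with `c = a/(|y|² + ε)`, `a = (N-2)/2`, a `C¹` version of the Hardy field
`a/|y|²`. With `N = 2a + 2`, the potential exceeds `a²/(|y|² + ε)` by a nonnegative remainder. -/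
lemma hardy_test_regularized (hN : 2 ≤ N) (hφ : ContDiff ℝ 1 φ) (hφc : HasCompactSupport φ)
    {ε : ℝ} (hε : 0 < ε) :
    ((N - 2) / 2 : ℝ) ^ 2 * ∫ y, φ y ^ 2 / (‖y‖ ^ 2 + ε) ∂measK N ≤
      ∫ y, ‖gradient φ y‖ ^ 2 ∂measK N := by
  have hφ0 := hφ.continuous
  have hcs : HasCompactSupport fun y => φ y ^ 2 := hφc.comp_left (g := fun t => t ^ 2) (by simp)
  have hN' : (2 : ℝ) ≤ N := by exact_mod_cast hN
  set a : ℝ := (N - 2) / 2 with ha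
  have ha0 : 0 ≤ a := by rw [ha]; linarith
  have hpos (y : Sp N) : 0 < ‖y‖ ^ 2 + ε := by positivity
  let c : Sp N → ℝ := fun y => a * (‖y‖ ^ 2 + ε)⁻¹
  have hc : ContDiff ℝ 1 c := contDiff_const.mul
    (((contDiff_norm_sq ℝ).add contDiff_const).inv fun y => (hpos y).ne')
  have hcd (y : Sp N) : fderiv ℝ c y y = - (a * (2 * ‖y‖ ^ 2) / (‖y‖ ^ 2 + ε) ^ 2) := by
    have h1 : HasFDerivAt (fun y : Sp N => ‖y‖ ^ 2) (2 • (innerSL ℝ y)) y :=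
      (hasStrictFDerivAt_norm_sq y).hasFDerivAt
    have h2 := ((hasDerivAt_inv (hpos y).ne').comp_hasFDerivAt y (h1.add_const ε)).const_mul a
    have e : c = fun x => a * ((fun x => x⁻¹) ∘ fun x : Sp N => ‖x‖ ^ 2 + ε) x := rfl
    rw [e, h2.fderiv]
    simp
    ring
  have h := integral_norm_gradient_add_sq hφ hφc hc
  have h0 : 0 ≤ ∫ y, ‖gradient φ y + (φ y * c y) • y‖ ^ 2 ∂measK N :=
    integral_nonneg fun y => by positivity
  rw [h, sub_nonneg] at h0
  refine le_trans ?_ h0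
  rw [← integral_const_mul]
  refine integral_mono_of_nonneg (Eventually.of_forall fun y => ?_) ?_
      (Eventually.of_forall fun y => ?_)
  · have := hpos y
    positivity
  · have hc0 := hc.continuous
    have hdc : Continuous fun y => fderiv ℝ c y y :=
      (hc.continuous_fderiv one_ne_zero).clm_apply continuous_id
    have : Continuous fun y => φ y ^ 2 * (N * c y + fderiv ℝ c y y +
        c y * ‖y‖ ^ 2 / 2 - c y ^ 2 * ‖y‖ ^ 2) := by fun_prop
    exact this.integrable_of_hasCompactSupport hcs.mul_right
  · have hp := hpos y
    simp only
    rw [hcd]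
    simp only [c]
    have key : a ^ 2 / (‖y‖ ^ 2 + ε) ≤ N * (a * (‖y‖ ^ 2 + ε)⁻¹) +
        -(a * (2 * ‖y‖ ^ 2) / (‖y‖ ^ 2 + ε) ^ 2) + a * (‖y‖ ^ 2 + ε)⁻¹ * ‖y‖ ^ 2 / 2 -
        (a * (‖y‖ ^ 2 + ε)⁻¹) ^ 2 * ‖y‖ ^ 2 := by
      have hNa : (N : ℝ) = 2 * a + 2 := by rw [ha]; ring
      have e : N * (a * (‖y‖ ^ 2 + ε)⁻¹) +
        -(a * (2 * ‖y‖ ^ 2) / (‖y‖ ^ 2 + ε) ^ 2) + a * (‖y‖ ^ 2 + ε)⁻¹ * ‖y‖ ^ 2 / 2 -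
        (a * (‖y‖ ^ 2 + ε)⁻¹) ^ 2 * ‖y‖ ^ 2 - a ^ 2 / (‖y‖ ^ 2 + ε) =
        a * (2 * ε + a * ε + (‖y‖ ^ 2 + ε) * ‖y‖ ^ 2 / 2) / (‖y‖ ^ 2 + ε) ^ 2 := by
        rw [hNa]
        field_simp
        ring
      have : 0 ≤ a * (2 * ε + a * ε + (‖y‖ ^ 2 + ε) * ‖y‖ ^ 2 / 2) / (‖y‖ ^ 2 + ε) ^ 2 := by
        positivity
      linarith
    calc a ^ 2 * (φ y ^ 2 / (‖y‖ ^ 2 + ε)) = φ y ^ 2 * (a ^ 2 / (‖y‖ ^ 2 + ε)) := by ring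
      _ ≤ _ := mul_le_mul_of_nonneg_left key (by positivity)

/-- Fatou's lemma along `ε = 1/(n+1)`; the origin, where pointwise convergence may fail, is a null
set. -/
lemma hardy_test (hN : 3 ≤ N) (hφ : ContDiff ℝ 1 φ) (hφc : HasCompactSupport φ) :
    eLpNorm (fun y => ‖y‖⁻¹ * φ y) 2 (measK N) ≤
      (Real.toNNReal (2 / (N - 2)) : ℝ≥0) * eLpNorm (gradient φ) 2 (measK N) := by
  have hφ0 := hφ.continuous
  have hN' : (3 : ℝ) ≤ N := by exact_mod_cast hN
  let f : ℕ → Sp N → ℝ := fun n y => (Real.sqrt (‖y‖ ^ 2 + 1 / ((n : ℝ) + 1)))⁻¹ * φ y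
  have hpos (n : ℕ) (y : Sp N) : 0 < ‖y‖ ^ 2 + 1 / ((n : ℝ) + 1) := by positivity
  have hfc (n : ℕ) : Continuous (f n) :=
    (Continuous.inv₀ (by fun_prop) fun y => (Real.sqrt_pos.2 (hpos n y)).ne').mul hφ0
  have hle (n : ℕ) : eLpNorm (f n) 2 (measK N) ≤
      (Real.toNNReal (2 / (N - 2)) : ℝ≥0) * eLpNorm (gradient φ) 2 (measK N) := by
    refine eLpNorm_two_le_of_integral_sq_le ((hfc n).memLp_of_hasCompactSupport hφc.mul_left)
      (memLp_gradient hφ hφc) ?_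
    have h := hardy_test_regularized (by omega) hφ hφc (ε := 1 / ((n : ℝ) + 1)) (by positivity)
    have e : ∫ y, ‖f n y‖ ^ 2 ∂measK N =
        ∫ y, φ y ^ 2 / (‖y‖ ^ 2 + 1 / ((n : ℝ) + 1)) ∂measK N := by
      congr 1
      funext y
      simp only [f, norm_mul, mul_pow, Real.norm_eq_abs, sq_abs, inv_pow,
        Real.sq_sqrt (hpos n y).le]
      ring
    rw [e, Real.coe_toNNReal _ (div_nonneg (by norm_num) (by linarith)), div_pow]
    have h2 : (0 : ℝ) < N - 2 := by linarith
    rw [div_mul_eq_mul_div, le_div_iff₀ (by positivity)]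
    rw [div_pow] at h
    linarith
  have hlim : ∀ᵐ y ∂measK N, Tendsto (fun n => f n y) atTop (𝓝 (‖y‖⁻¹ * φ y)) := by
    have : NeZero N := ⟨by omega⟩
    have h0 : ∀ᵐ y ∂measK N, y ≠ 0 := measK_absolutelyContinuous.ae_le (Measure.ae_ne volume 0)
    filter_upwards [h0] with y hy
    have h1 : Tendsto (fun n : ℕ => Real.sqrt (‖y‖ ^ 2 + 1 / ((n : ℝ) + 1))) atTop (𝓝 ‖y‖) := by
      have := (tendsto_one_div_add_atTop_nhds_zero_nat (𝕜 := ℝ)).const_add (‖y‖ ^ 2)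
      have := (Real.continuous_sqrt.tendsto _).comp this
      simpa [Function.comp_def] using this
    exact (h1.inv₀ (norm_ne_zero_iff.2 hy)).mul_const _
  refine (Lp.eLpNorm_lim_le_liminf_eLpNorm (fun n => (hfc n).aestronglyMeasurable) _ hlim).trans ?_
  refine liminf_le_of_le (by isBoundedDefault) fun b hb => ?_
  obtain ⟨n, hn⟩ := hb.exists
  exact hn.trans (hle n)

end Test

lemma two_lt_critExp (hN : 3 ≤ N) : 2 < critExp N := by
  have hN' : (3 : ℝ) ≤ N := by exact_mod_cast hN
  rw [critExp, lt_div_iff₀ (by linarith)]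
  linarith

lemma critExp_inv (hN : 3 ≤ N) : (critExp N)⁻¹ = 2⁻¹ - (N : ℝ)⁻¹ := by
  have hN' : (3 : ℝ) ≤ N := by exact_mod_cast hN
  have : (N : ℝ) - 2 ≠ 0 := by linarith
  rw [critExp]
  field_simp

/-- Apply the unweighted Sobolev inequality to `u = K^{1/2} φ`. Its Dirichlet integral is at most
that of `φ` by the identity with `c = 1/4`, and `|φ|^{2^*} K ≤ |u|^{2^*}` because `K ≥ 1` and `2^* >
2`. -/
lemma exists_sobolev_test (hN : 3 ≤ N) : ∃ C : ℝ≥0, ∀ φ : Sp N → ℝ, ContDiff ℝ 1 φ →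
    HasCompactSupport φ → eLpNorm φ (ENNReal.ofReal (critExp N)) (measK N) ≤
      C * eLpNorm (gradient φ) 2 (measK N) := by
  have hq := two_lt_critExp hN
  refine ⟨SNormLESNormFDerivOfEqConst ℝ (volume : Measure (Sp N)) 2, fun φ hφ hφc => ?_⟩
  let s : Sp N → ℝ := fun y => Real.exp (‖y‖ ^ 2 / 8)
  have hs : ContDiff ℝ 1 s := Real.contDiff_exp.comp ((contDiff_norm_sq ℝ).div_const 8)
  have hs1 (y : Sp N) : 1 ≤ s y := Real.one_le_exp (by positivity)
  have hs2 (y : Sp N) : s y ^ 2 = weight N y := by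
    simp only [s, weight]
    rw [← Real.exp_nat_mul]
    congr 1
    push_cast
    ring
  let u : Sp N → ℝ := fun y => φ y * s y
  have hu : ContDiff ℝ 1 u := hφ.mul hs
  have huc : HasCompactSupport u := hφc.mul_right
  have hgrad (y : Sp N) : gradient u y = s y • (gradient φ y + (φ y * (1 / 4)) • y) := by
    have h1 : HasFDerivAt (fun y : Sp N => ‖y‖ ^ 2) (2 • (innerSL ℝ y)) y :=
      (hasStrictFDerivAt_norm_sq y).hasFDerivAt
    have h2 : HasFDerivAt s _ y := (h1.mul_const (1 / 8 : ℝ)).exp.congr_of_eventuallyEq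
      (Eventually.of_forall fun z => by simp [s, div_eq_mul_inv])
    have h3 := ((hφ.differentiable one_ne_zero y).hasFDerivAt.mul h2).fderiv
    refine ext_inner_right ℝ fun z => ?_
    rw [inner_gradient_eq, show u = φ * s from rfl, h3]
    simp [inner_add_left, inner_smul_left, s, div_eq_mul_inv]
    ring
  have hG : eLpNorm (fderiv ℝ u) 2 volume ≤ eLpNorm (gradient φ) 2 (measK N) := by
    have hmem : MemLp (fderiv ℝ u) 2 volume :=
      (hu.continuous_fderiv one_ne_zero).memLp_of_hasCompactSupport (huc.fderiv (𝕜 := ℝ))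
    have h := eLpNorm_two_le_of_integral_sq_le (c := 1) hmem (memLp_gradient hφ hφc) ?_
    · simpa using h
    have e : ∫ y, ‖fderiv ℝ u y‖ ^ 2 =
        ∫ y, ‖gradient φ y + (φ y * (1 / 4)) • y‖ ^ 2 ∂measK N := by
      rw [integral_measK]
      congr 1
      funext y
      rw [← norm_gradient, hgrad, norm_smul, mul_pow, Real.norm_eq_abs, sq_abs, hs2]
    rw [e, integral_norm_gradient_add_quarter_sq hφ hφc]
    have : 0 ≤ ∫ y, φ y ^ 2 * (N / 4 + ‖y‖ ^ 2 / 16) ∂measK N :=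
      integral_nonneg fun y => by positivity
    simp
    linarith
  have hS := eLpNorm_le_eLpNorm_fderiv_of_eq (volume : Measure (Sp N)) hu huc (p := 2)
    (p' := (critExp N).toNNReal) (by norm_num) (by simp; omega)
    (by rw [Real.coe_toNNReal _ (by linarith), critExp_inv hN]; simp)
  refine le_trans ?_ (hS.trans (mul_le_mul_right hG _))
  have hq0 : ENNReal.ofReal (critExp N) ≠ 0 := by simp; linarith
  have e : ((critExp N).toNNReal : ℝ≥0∞) = ENNReal.ofReal (critExp N) := rfl
  rw [e, eLpNorm_eq_lintegral_rpow_enorm_toReal hq0 (by simp),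
    eLpNorm_eq_lintegral_rpow_enorm_toReal hq0 (by simp), ENNReal.toReal_ofReal (by linarith)]
  refine ENNReal.rpow_le_rpow ?_ (by simp; linarith)
  rw [measK, lintegral_withDensity_eq_lintegral_mul₀ measurable_ofReal_weight.aemeasurable]
  · refine lintegral_mono fun y => ?_
    simp only [Pi.mul_apply, u, enorm_mul]
    rw [ENNReal.mul_rpow_of_nonneg _ _ (by linarith), mul_comm]
    refine mul_le_mul_right ?_ _
    have hs0 : 0 < s y := Real.exp_pos _
    rw [Real.enorm_eq_ofReal hs0.le, ENNReal.ofReal_rpow_of_pos hs0, ← hs2]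
    refine ENNReal.ofReal_le_ofReal ?_
    rw [← Real.rpow_natCast]
    exact Real.rpow_le_rpow_of_exponent_le (hs1 y) (by push_cast; linarith)
  · exact (hφ.continuous.enorm.measurable.pow_const _).aemeasurable

/-! ### Translations and ball averages in `L²`. -/

lemma eLpNorm_two_sq {α E : Type*} [MeasurableSpace α] [NormedAddCommGroup E] {ν : Measure α}
    {f : α → E} : eLpNorm f 2 ν ^ 2 = ∫⁻ x, ‖f x‖ₑ ^ 2 ∂ν := by
  rw [eLpNorm_eq_lintegral_rpow_enorm_toReal (by simp) (by simp), ← ENNReal.rpow_natCast,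
    ← ENNReal.rpow_mul]
  simp

lemma enorm_integral_sq_le {α E : Type*} [MeasurableSpace α] [NormedAddCommGroup E]
    [NormedSpace ℝ E] {ν : Measure α} [IsProbabilityMeasure ν] {f : α → E}
    (hf : AEStronglyMeasurable f ν) :
    ‖∫ x, f x ∂ν‖ₑ ^ 2 ≤ ∫⁻ x, ‖f x‖ₑ ^ 2 ∂ν := by
  have h1 : ‖∫ x, f x ∂ν‖ₑ ≤ eLpNorm f 2 ν :=
    (enorm_integral_le_lintegral_enorm f).trans
      (eLpNorm_one_eq_lintegral_enorm.symm.trans_le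
        (eLpNorm_le_eLpNorm_of_exponent_le (by norm_num) hf))
  calc ‖∫ x, f x ∂ν‖ₑ ^ 2 ≤ eLpNorm f 2 ν ^ 2 := by gcongr
    _ = _ := eLpNorm_two_sq

/-- Write the increment as an integral of the derivative along the segment, then use Jensen, Tonelli
and translation invariance. -/
lemma lintegral_enorm_translate_sub_sq_le {φ : Sp N → ℝ} (hφ : ContDiff ℝ 1 φ) (h : Sp N) :
    ∫⁻ x, ‖φ (x + h) - φ x‖ₑ ^ 2 ≤ ‖h‖ₑ ^ 2 * ∫⁻ x, ‖gradient φ x‖ₑ ^ 2 := by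
  have hd : Continuous (fderiv ℝ φ) := hφ.continuous_fderiv one_ne_zero
  have hg := continuous_gradient hφ
  let ν : Measure ℝ := volume.restrict (Ioc 0 1)
  have : IsProbabilityMeasure ν := ⟨by simp [ν]⟩
  have hpt (x : Sp N) : φ (x + h) - φ x = ∫ t, fderiv ℝ φ (x + t • h) h ∂ν := by
    have h1 (t : ℝ) : HasDerivAt (fun t : ℝ => φ (x + t • h)) (fderiv ℝ φ (x + t • h) h) t := by
      have h2 : HasDerivAt (fun t : ℝ => x + t • h) h t := by
        simpa using ((hasDerivAt_id t).smul_const h).const_add x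
      exact (hφ.differentiable one_ne_zero _).hasFDerivAt.comp_hasDerivAt t h2
    have h3 := intervalIntegral.integral_eq_sub_of_hasDerivAt (a := 0) (b := 1)
      (fun t _ => h1 t) ((hd.comp (by fun_prop)).clm_apply continuous_const).continuousOn.intervalIntegrable
    rw [intervalIntegral.integral_of_le zero_le_one] at h3
    rw [h3]
    simp
  calc ∫⁻ x, ‖φ (x + h) - φ x‖ₑ ^ 2
      ≤ ∫⁻ x, ∫⁻ t, ‖h‖ₑ ^ 2 * ‖gradient φ (x + t • h)‖ₑ ^ 2 ∂ν := by
        refine lintegral_mono fun x => ?_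
        simp only
        rw [hpt]
        refine (enorm_integral_sq_le ?_).trans (lintegral_mono fun t => ?_)
        · exact ((hd.comp (by fun_prop)).clm_apply continuous_const).aestronglyMeasurable
        · rw [← mul_pow, ← inner_gradient_eq]
          refine pow_le_pow_left' ?_ 2
          rw [mul_comm]
          simp only [← ofReal_norm, ← ENNReal.ofReal_mul (norm_nonneg _)]
          exact ENNReal.ofReal_le_ofReal (norm_inner_le_norm _ _)
    _ = ∫⁻ t, (∫⁻ x, ‖h‖ₑ ^ 2 * ‖gradient φ (x + t • h)‖ₑ ^ 2) ∂ν := by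
        refine lintegral_lintegral_swap (Continuous.aemeasurable ?_)
        have : Continuous fun p : Sp N × ℝ => gradient φ (p.1 + p.2 • h) := hg.comp (by fun_prop)
        exact ENNReal.continuous_const_mul (by simp) |>.comp ((ENNReal.continuous_pow 2).comp this.enorm)
    _ = ∫⁻ _, (‖h‖ₑ ^ 2 * ∫⁻ x, ‖gradient φ x‖ₑ ^ 2) ∂ν := by
        refine lintegral_congr fun t => ?_
        rw [lintegral_const_mul' _ _ (by simp)]
        congr 1
        exact lintegral_add_right_eq_self (fun x => ‖gradient φ x‖ₑ ^ 2) (t • h)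
    _ = _ := by simp

/-- The mean of `u` over the ball of radius `r` about `x`. -/
def ballAvg (r : ℝ) (u : Sp N → ℝ) (x : Sp N) : ℝ :=
  (volume.real (Metric.ball (0 : Sp N) r))⁻¹ * ∫ z in Metric.ball x r, u z

/-- Jensen over the ball reduces this to translations by `|h| < r`. The weight on the right is
harmless since `K ≥ 1`. Ball averages replace a Rellich theorem in the compactness proof. -/
lemma ballAvg_test {φ : Sp N → ℝ} (hφ : ContDiff ℝ 1 φ) (hφc : HasCompactSupport φ)
    {r : ℝ} (hr : 0 < r) :
    eLpNorm (fun x => φ x - ballAvg r φ x) 2 volume ≤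
      (r.toNNReal : ℝ≥0) * eLpNorm (gradient φ) 2 (measK N) := by
  have hφ0 := hφ.continuous
  let s : Set (Sp N) := Metric.ball 0 r
  have hs0 : volume s ≠ 0 := (Metric.measure_ball_pos _ _ hr).ne'
  have hs1 : volume s ≠ ⊤ := measure_ball_lt_top.ne
  let ρ : Measure (Sp N) := (volume s)⁻¹ • volume.restrict s
  have : IsProbabilityMeasure ρ := ⟨by simp [ρ, ENNReal.inv_mul_cancel hs0 hs1]⟩
  have hpt (x : Sp N) : φ x - ballAvg r φ x = ∫ h, (φ x - φ (x + h)) ∂ρ := by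
    have hi : Integrable (fun h => φ (x + h)) ρ := by
      refine Integrable.smul_measure ?_ (by simp [hs0])
      have h1 : Integrable φ volume := hφ0.integrable_of_hasCompactSupport hφc
      exact (h1.comp_add_left x).restrict
    rw [integral_sub (integrable_const _) hi]
    simp only [integral_const, probReal_univ, one_smul, ballAvg]
    congr 1
    rw [integral_smul_measure, ENNReal.toReal_inv, smul_eq_mul]
    congr 1
    rw [← integral_indicator measurableSet_ball, ← integral_indicator measurableSet_ball,
      ← integral_add_left_eq_self _ x]
    congr 1
    funext h
    simp [indicator]
  rw [← (ENNReal.pow_right_strictMono two_ne_zero).le_iff_le, mul_pow]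
  rw [eLpNorm_two_sq, eLpNorm_two_sq]
  calc ∫⁻ x, ‖φ x - ballAvg r φ x‖ₑ ^ 2
      ≤ ∫⁻ x, ∫⁻ h, ‖φ x - φ (x + h)‖ₑ ^ 2 ∂ρ := by
        refine lintegral_mono fun x => ?_
        simp only
        rw [hpt]
        refine enorm_integral_sq_le ?_
        exact (by fun_prop : Continuous fun h => φ x - φ (x + h)).aestronglyMeasurable
    _ = ∫⁻ h, (∫⁻ x, ‖φ x - φ (x + h)‖ₑ ^ 2) ∂ρ := by
        refine lintegral_lintegral_swap (Continuous.aemeasurable ?_)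
        have : Continuous fun p : Sp N × Sp N => φ p.1 - φ (p.1 + p.2) := by fun_prop
        exact (ENNReal.continuous_pow 2).comp this.enorm
    _ ≤ ∫⁻ _, (r.toNNReal : ℝ≥0∞) ^ 2 * (∫⁻ x, ‖gradient φ x‖ₑ ^ 2) ∂ρ := by
        refine lintegral_mono_ae ?_
        refine Measure.ae_smul_measure ?_ _
        filter_upwards [ae_restrict_mem measurableSet_ball] with h hh
        have h1 := lintegral_enorm_translate_sub_sq_le hφ h
        simp_rw [← enorm_neg (φ (_ + h) - _), neg_sub] at h1
        refine h1.trans (mul_le_mul_left ?_ _)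
        refine pow_le_pow_left' ?_ 2
        rw [← ofReal_norm]
        exact ENNReal.ofReal_le_ofReal (by simpa [s] using (mem_ball_zero_iff.1 hh).le)
    _ ≤ _ := by
        simp only [lintegral_const, measure_univ, mul_one]
        gcongr
        exact volume_le_measK

/-! ### The space `X`: inequalities extended by density, injectivity into `L²_K`. -/

/-- `v ↦ v`, as a continuous linear map from `X` to `L²_K`. -/
def fnL (N : ℕ) : X N →L[ℝ] L2K N :=
  (WithLp.fstL 2 ℝ (L2K N) (L2Kvec N)).comp (testGraph N).topologicalClosure.subtypeL

/-- `v ↦ ∇v`, as a continuous linear map. -/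
def gradL (N : ℕ) : X N →L[ℝ] L2Kvec N :=
  (WithLp.sndL 2 ℝ (L2K N) (L2Kvec N)).comp (testGraph N).topologicalClosure.subtypeL

lemma fnL_apply (v : X N) : fnL N v = v.fn := rfl

lemma gradL_apply (v : X N) : gradL N v = v.grad := rfl

lemma X.fn_add (v w : X N) : (v + w).fn = v.fn + w.fn := map_add (fnL N) v w

lemma X.fn_sub (v w : X N) : (v - w).fn = v.fn - w.fn := map_sub (fnL N) v w

lemma X.fn_smul (c : ℝ) (v : X N) : (c • v).fn = c • v.fn := map_smul (fnL N) c v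

lemma X.norm_sq (v : X N) : ‖v‖ ^ 2 = ‖v.fn‖ ^ 2 + ‖v.grad‖ ^ 2 :=
  WithLp.prod_norm_sq_eq_of_L2 v.1

lemma X.exists_test_seq (v : X N) : ∃ φ : ℕ → Sp N → ℝ, (∀ n, ContDiff ℝ ∞ (φ n)) ∧
    (∀ n, HasCompactSupport (φ n)) ∧
    Tendsto (fun n => eLpNorm (φ n - ⇑v.fn) 2 (measK N)) atTop (𝓝 0) ∧
    Tendsto (fun n => eLpNorm (gradient (φ n) - ⇑v.grad) 2 (measK N)) atTop (𝓝 0) ∧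
    ∀ᵐ y ∂measK N, Tendsto (fun n => φ n y) atTop (𝓝 (v.fn y)) := by
  have hv : v.1 ∈ closure (testGraph N : Set (WithLp 2 (L2K N × L2Kvec N))) := v.2
  obtain ⟨p, hp, hlim⟩ := mem_closure_iff_seq_limit.1 hv
  choose φ hφ hφc h1 h2 using hp
  have l1 : Tendsto (fun n => eLpNorm (φ n - ⇑v.fn) 2 (measK N)) atTop (𝓝 0) := by
    have := ((WithLp.fstL 2 ℝ (L2K N) (L2Kvec N)).continuous.tendsto _).comp hlim
    rw [Lp.tendsto_Lp_iff_tendsto_eLpNorm'] at this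
    refine this.congr fun n => eLpNorm_congr_ae ?_
    filter_upwards [h1 n] with y hy
    simp only [Pi.sub_apply, ← hy]
    rfl
  have l2 : Tendsto (fun n => eLpNorm (gradient (φ n) - ⇑v.grad) 2 (measK N)) atTop (𝓝 0) := by
    have := ((WithLp.sndL 2 ℝ (L2K N) (L2Kvec N)).continuous.tendsto _).comp hlim
    rw [Lp.tendsto_Lp_iff_tendsto_eLpNorm'] at this
    refine this.congr fun n => eLpNorm_congr_ae ?_
    filter_upwards [h2 n] with y hy
    simp only [Pi.sub_apply, ← hy]
    rfl
  obtain ⟨ns, hns, hae⟩ := (tendstoInMeasure_of_tendsto_eLpNorm (by simp)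
    (fun n => (hφ n).continuous.aestronglyMeasurable) (Lp.aestronglyMeasurable v.fn)
    l1).exists_seq_tendsto_ae
  exact ⟨fun n => φ (ns n), fun n => hφ _, fun n => hφc _, l1.comp hns.tendsto_atTop,
    l2.comp hns.tendsto_atTop, hae⟩

/-- An estimate of a transform `T` by the gradient extends from test functions to `X`. -/
lemma X.eLpNorm_le_of_test {ν : Measure (Sp N)} {p : ℝ≥0∞} {C : ℝ≥0}
    (T : (Sp N → ℝ) → Sp N → ℝ)
    (hm : ∀ φ, ContDiff ℝ 1 φ → HasCompactSupport φ → AEStronglyMeasurable (T φ) ν)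
    (hT : ∀ φ, ContDiff ℝ 1 φ → HasCompactSupport φ →
      eLpNorm (T φ) p ν ≤ C * eLpNorm (gradient φ) 2 (measK N))
    (hlim : ∀ (v : X N) (φ : ℕ → Sp N → ℝ), (∀ n, ContDiff ℝ 1 (φ n)) →
      (∀ n, HasCompactSupport (φ n)) →
      Tendsto (fun n => eLpNorm (φ n - ⇑v.fn) 2 (measK N)) atTop (𝓝 0) →
      (∀ᵐ y ∂measK N, Tendsto (fun n => φ n y) atTop (𝓝 (v.fn y))) →
      ∀ᵐ y ∂ν, Tendsto (fun n => T (φ n) y) atTop (𝓝 (T v.fn y))) (v : X N) :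
    eLpNorm (T v.fn) p ν ≤ C * ENNReal.ofReal ‖v.grad‖ := by
  obtain ⟨φ, hφ, hφc, l1, l2, hae⟩ := X.exists_test_seq v
  have hφ1 (n : ℕ) : ContDiff ℝ 1 (φ n) := (hφ n).of_le (by simp)
  -- Fatou along an a.e. convergent sequence of test functions: `T` itself need not be continuous on
  -- `L²_K`.
  refine (Lp.eLpNorm_lim_le_liminf_eLpNorm (fun n => hm _ (hφ1 n) (hφc n)) _
    (hlim v φ hφ1 hφc l1 hae)).trans ?_
  have hnorm : ENNReal.ofReal ‖v.grad‖ = eLpNorm v.grad 2 (measK N) := by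
    rw [ofReal_norm, Lp.enorm_def]
  have hb (n : ℕ) : eLpNorm (T (φ n)) p ν ≤ C * (eLpNorm (gradient (φ n) - ⇑v.grad) 2 (measK N) +
      ENNReal.ofReal ‖v.grad‖) := by
    refine (hT _ (hφ1 n) (hφc n)).trans (mul_le_mul_right ?_ _)
    rw [hnorm]
    have hmg : AEStronglyMeasurable (gradient (φ n)) (measK N) :=
      (continuous_gradient (hφ1 n)).aestronglyMeasurable
    have := eLpNorm_add_le (p := 2) (μ := measK N) (hmg.sub (Lp.aestronglyMeasurable v.grad))
      (Lp.aestronglyMeasurable v.grad) (by norm_num)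
    simpa using this
  have hl : Tendsto (fun n => (C : ℝ≥0∞) * (eLpNorm (gradient (φ n) - ⇑v.grad) 2 (measK N) +
      ENNReal.ofReal ‖v.grad‖)) atTop (𝓝 (C * ENNReal.ofReal ‖v.grad‖)) := by
    have := l2.add_const (ENNReal.ofReal ‖v.grad‖)
    rw [zero_add] at this
    exact ENNReal.Tendsto.const_mul this (Or.inr (by simp))
  rw [← hl.liminf_eq]
  exact liminf_le_liminf (Eventually.of_forall hb)

lemma X.poincare (v : X N) : N / 2 * ‖v.fn‖ ^ 2 ≤ ‖v.grad‖ ^ 2 := by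
  have hv : v.1 ∈ closure (testGraph N : Set (WithLp 2 (L2K N × L2Kvec N))) := v.2
  have key : closure (testGraph N : Set (WithLp 2 (L2K N × L2Kvec N))) ⊆
      {p | N / 2 * ‖p.fst‖ ^ 2 ≤ ‖p.snd‖ ^ 2} := by
    refine closure_minimal ?_ (isClosed_le ?_ ?_)
    · rintro p ⟨φ, hφ, hφc, h1, h2⟩
      have e1 : ‖p.fst‖ ^ 2 = ∫ y, φ y ^ 2 ∂measK N := by
        rw [← real_inner_self_eq_norm_sq, L2.inner_def]
        refine integral_congr_ae ?_
        filter_upwards [h1] with y hy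
        simp [hy]
      have e2 : ‖p.snd‖ ^ 2 = ∫ y, ‖gradient φ y‖ ^ 2 ∂measK N := by
        rw [← real_inner_self_eq_norm_sq, L2.inner_def]
        refine integral_congr_ae ?_
        filter_upwards [h2] with y hy
        simp only [hy, real_inner_self_eq_norm_sq]
      simp only [mem_ofPred_eq, e1, e2]
      exact poincare_test (hφ.of_le (by simp)) hφc
    · exact continuous_const.mul
        ((WithLp.fstL 2 ℝ (L2K N) (L2Kvec N)).continuous.norm.pow 2)
    · exact (WithLp.sndL 2 ℝ (L2K N) (L2Kvec N)).continuous.norm.pow 2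
  exact key hv

lemma X.eLpNorm_norm_mul_le (v : X N) :
    eLpNorm (fun y => ‖y‖ * v.fn y) 2 (measK N) ≤ (4 : ℝ≥0) * ENNReal.ofReal ‖v.grad‖ := by
  refine X.eLpNorm_le_of_test (fun u y => ‖y‖ * u y) (fun φ hφ _ => ?_)
    (fun φ hφ hφc => norm_mul_test hφ hφc) (fun v φ _ _ _ h => ?_) v
  · have := hφ.continuous
    exact (by fun_prop : Continuous fun y : Sp N => ‖y‖ * φ y).aestronglyMeasurable
  · filter_upwards [h] with y hy using hy.const_mul _

lemma X.hardy (hN : 3 ≤ N) (v : X N) :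
    eLpNorm (fun y => ‖y‖⁻¹ * v.fn y) 2 (measK N) ≤
      (Real.toNNReal (2 / (N - 2)) : ℝ≥0) * ENNReal.ofReal ‖v.grad‖ := by
  refine X.eLpNorm_le_of_test (fun u y => ‖y‖⁻¹ * u y) (fun φ hφ _ => ?_)
    (fun φ hφ hφc => hardy_test hN hφ hφc) (fun v φ _ _ _ h => ?_) v
  · exact (measurable_norm.inv.mul hφ.continuous.measurable).aestronglyMeasurable
  · filter_upwards [h] with y hy using hy.const_mul _

lemma X.exists_sobolev (hN : 3 ≤ N) : ∃ C : ℝ≥0, ∀ v : X N,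
    eLpNorm v.fn (ENNReal.ofReal (critExp N)) (measK N) ≤ C * ENNReal.ofReal ‖v.grad‖ := by
  obtain ⟨C, hC⟩ := exists_sobolev_test hN
  exact ⟨C, fun v => X.eLpNorm_le_of_test id (fun φ hφ _ => hφ.continuous.aestronglyMeasurable)
    hC (fun v φ _ _ _ h => h) v⟩

lemma memLp_volume {E : Type*} [NormedAddCommGroup E] {p : ℝ≥0∞} {f : Sp N → E}
    (hf : MemLp f p (measK N)) : MemLp f p volume := hf.mono_measure volume_le_measK

/-- Integration over a ball is a continuous linear functional on `L²_K`. -/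
lemma exists_clm_integral_ball (x : Sp N) (r : ℝ) :
    ∃ ℓ : L2K N →L[ℝ] ℝ, ∀ u : L2K N, ℓ u = ∫ y in Metric.ball x r, u y := by
  -- The functional is the `K`-inner product with `1_B K⁻¹`, which undoes the weight.
  have hw : MemLp ((Metric.ball x r).indicator fun y => (weight N y)⁻¹) 2 (measK N) := by
    rw [memLp_indicator_iff_restrict measurableSet_ball]
    have : IsFiniteMeasure ((measK N).restrict (Metric.ball x r)) :=
      ⟨by simpa using measure_ball_lt_top⟩
    refine MemLp.of_bound continuous_weight.measurable.inv.aestronglyMeasurable 1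
      (Eventually.of_forall fun y => ?_)
    simpa [abs_of_pos (weight_pos y)] using inv_le_one_of_one_le₀ (one_le_weight y)
  refine ⟨innerSL ℝ hw.toLp, fun u => ?_⟩
  rw [innerSL_apply_apply, L2.inner_def, ← integral_indicator measurableSet_ball]
  have e : ∫ y, inner ℝ ((hw.toLp : L2K N) y) (u y) ∂measK N =
      ∫ y, (Metric.ball x r).indicator (fun y => (weight N y)⁻¹) y * u y ∂measK N := by
    refine integral_congr_ae ?_
    filter_upwards [hw.coeFn_toLp] with y hy
    simp [hy, mul_comm]
  rw [e, integral_measK]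
  congr 1
  funext y
  by_cases hy : y ∈ Metric.ball x r
  · simp [hy, (weight_pos y).ne']
  · simp [hy]

lemma stronglyMeasurable_ballAvg (r : ℝ) {u : Sp N → ℝ} (hu : StronglyMeasurable u) :
    StronglyMeasurable (ballAvg r u) := by
  have e : ballAvg r u = fun x => (volume.real (Metric.ball (0 : Sp N) r))⁻¹ *
      ∫ z in Metric.ball (0 : Sp N) r, u (x + z) := by
    funext x
    rw [ballAvg, ← integral_indicator measurableSet_ball, ← integral_indicator measurableSet_ball,
      ← integral_add_left_eq_self _ x]
    congr 2
    funext h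
    simp [indicator]
  rw [e]
  exact (StronglyMeasurable.integral_prod_right
    (f := fun x z : Sp N => u (x + z))
    (hu.comp_measurable (measurable_fst.add measurable_snd))).const_mul _

lemma X.eLpNorm_sub_ballAvg_le {r : ℝ} (hr : 0 < r) (v : X N) :
    eLpNorm (fun x => v.fn x - ballAvg r v.fn x) 2 volume ≤
      (r.toNNReal : ℝ≥0) * ENNReal.ofReal ‖v.grad‖ := by
  refine X.eLpNorm_le_of_test (fun u x => u x - ballAvg r u x) (fun φ hφ hφc => ?_)
    (fun φ hφ hφc => ballAvg_test hφ hφc hr) (fun v φ hφ hφc hl h => ?_) v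
  · have hφ0 := hφ.continuous
    exact hφ0.aestronglyMeasurable.sub
      (stronglyMeasurable_ballAvg r hφ0.stronglyMeasurable).aestronglyMeasurable
  · filter_upwards [volume_absolutelyContinuous_measK.ae_le h] with x hx
    refine hx.sub (Tendsto.const_mul _ ?_)
    obtain ⟨ℓ, hℓ⟩ := exists_clm_integral_ball x r
    have hm (n : ℕ) : MemLp (φ n) 2 (measK N) :=
      (hφ n).continuous.memLp_of_hasCompactSupport (hφc n)
    have h1 : Tendsto (fun n => (hm n).toLp) atTop (𝓝 v.fn) := by
      rw [Lp.tendsto_Lp_iff_tendsto_eLpNorm']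
      refine hl.congr fun n => eLpNorm_congr_ae ?_
      filter_upwards [(hm n).coeFn_toLp] with y hy
      simp [hy]
    have h2 := (ℓ.continuous.tendsto _).comp h1
    simp only [Function.comp_def, hℓ] at h2
    refine h2.congr fun n => ?_
    refine setIntegral_congr_ae measurableSet_ball ?_
    filter_upwards [volume_absolutelyContinuous_measK.ae_le (hm n).coeFn_toLp] with y hy _ using hy

/-- An element of `X` is determined by its underlying function. -/
lemma fnL_injective : Function.Injective (fnL N) := by
  rw [injective_iff_map_eq_zero]
  intro v hv
  have hv0 : v.fn = 0 := hv
  suffices hg : v.grad = 0 by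
    have := X.norm_sq v
    rw [hv0, hg] at this
    simpa using this
  obtain ⟨φ, hφ, hφc, l1, l2, -⟩ := X.exists_test_seq v
  have hφ1 (n : ℕ) : ContDiff ℝ 1 (φ n) := (hφ n).of_le (by simp)
  have hmg (n : ℕ) : MemLp (gradient (φ n)) 2 (measK N) := memLp_gradient (hφ1 n) (hφc n)
  have hm (n : ℕ) : MemLp (φ n) 2 (measK N) :=
    (hφ n).continuous.memLp_of_hasCompactSupport (hφc n)
  have hl1 : Tendsto (fun n => (hm n).toLp) atTop (𝓝 v.fn) := by
    rw [Lp.tendsto_Lp_iff_tendsto_eLpNorm']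
    refine l1.congr fun n => eLpNorm_congr_ae ?_
    filter_upwards [(hm n).coeFn_toLp] with y hy
    simp [hy]
  have hl2 : Tendsto (fun n => (hmg n).toLp) atTop (𝓝 v.grad) := by
    rw [Lp.tendsto_Lp_iff_tendsto_eLpNorm']
    refine l2.congr fun n => eLpNorm_congr_ae ?_
    filter_upwards [(hmg n).coeFn_toLp] with y hy
    simp [hy]
  -- The second component is the distributional gradient of the first: integrate by parts for the
  -- approximating test functions and pass to the limit. The factors `K⁻¹` in `m1` and `m2` turn
  -- pairings in `L²_K` into integrals against `dy`.
  have key (ψ : Sp N → ℝ) (hψ : ContDiff ℝ ∞ ψ) (hψc : HasCompactSupport ψ) (e : Sp N) :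
      ∫ y, ψ y * inner ℝ (v.grad y) e = 0 := by
    have hψ1 : ContDiff ℝ 1 ψ := hψ.of_le (by simp)
    have hwi : Continuous fun y => (weight N y)⁻¹ :=
      continuous_weight.inv₀ fun y => (weight_pos y).ne'
    have hd : Continuous fun y => fderiv ℝ ψ y e :=
      (hψ1.continuous_fderiv one_ne_zero).clm_apply continuous_const
    have hdc : HasCompactSupport fun y => fderiv ℝ ψ y e := hψc.fderiv_apply (𝕜 := ℝ) e
    have m1 : MemLp (fun y => (weight N y)⁻¹ * fderiv ℝ ψ y e) 2 (measK N) :=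
      (hwi.mul hd).memLp_of_hasCompactSupport hdc.mul_left
    have m2 : MemLp (fun y => ((weight N y)⁻¹ * ψ y) • e) 2 (measK N) :=
      ((hwi.mul hψ.continuous).smul continuous_const).memLp_of_hasCompactSupport
        (hψc.mul_left.smul_right (f' := fun _ => e))
    have i1 (u : L2K N) : inner ℝ u m1.toLp = ∫ y, u y * fderiv ℝ ψ y e := by
      rw [L2.inner_def, ← integral_congr_ae (f := fun y =>
        (weight N y)⁻¹ * (u y * fderiv ℝ ψ y e)), integral_measK]
      · congr 1
        funext y
        rw [mul_inv_cancel_left₀ (weight_pos y).ne']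
      · filter_upwards [m1.coeFn_toLp] with y hy
        simp [hy]
        ring
    have i2 (u : L2Kvec N) : inner ℝ u m2.toLp = ∫ y, ψ y * inner ℝ (u y) e := by
      rw [L2.inner_def, ← integral_congr_ae (f := fun y =>
        (weight N y)⁻¹ * (ψ y * inner ℝ (u y) e)), integral_measK]
      · congr 1
        funext y
        rw [mul_inv_cancel_left₀ (weight_pos y).ne']
      · filter_upwards [m2.coeFn_toLp] with y hy
        simp [hy, inner_smul_right]
        ring
    have hibp (n : ℕ) : inner ℝ (hmg n).toLp m2.toLp = - inner ℝ (hm n).toLp m1.toLp := by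
      rw [i1, i2]
      have e1 : ∫ y, ψ y * inner ℝ (((hmg n).toLp : L2Kvec N) y) e = ∫ y, fderiv ℝ (φ n) y e * ψ y := by
        refine integral_congr_ae ?_
        filter_upwards [volume_absolutelyContinuous_measK.ae_le (hmg n).coeFn_toLp] with y hy
        rw [hy, inner_gradient_eq, mul_comm]
      have e2 : ∫ y, ((hm n).toLp : L2K N) y * fderiv ℝ ψ y e = ∫ y, φ n y * fderiv ℝ ψ y e := by
        refine integral_congr_ae ?_
        filter_upwards [volume_absolutelyContinuous_measK.ae_le (hm n).coeFn_toLp] with y hy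
        rw [hy]
      rw [e1, e2, integral_mul_fderiv_eq_neg_fderiv_mul_of_integrable, neg_neg]
      · exact (((hφ1 n).continuous_fderiv one_ne_zero).clm_apply continuous_const |>.mul
          hψ.continuous).integrable_of_hasCompactSupport hψc.mul_left
      · exact ((hφ n).continuous.mul hd).integrable_of_hasCompactSupport hdc.mul_left
      · exact ((hφ n).continuous.mul hψ.continuous).integrable_of_hasCompactSupport hψc.mul_left
      · exact fun y _ => (hφ1 n).differentiable one_ne_zero y
      · exact fun y _ => hψ1.differentiable one_ne_zero y
    have T1 := (hl2.inner tendsto_const_nhds (g := fun _ => m2.toLp) (𝕜 := ℝ))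
    have T2 := (hl1.inner tendsto_const_nhds (g := fun _ => m1.toLp) (𝕜 := ℝ)).neg
    rw [hv0, inner_zero_left, neg_zero] at T2
    rw [← i2]
    exact tendsto_nhds_unique T1 (T2.congr fun n => (hibp n).symm)
  have hzero (e : Sp N) : ∀ᵐ y, inner ℝ (v.grad y) e = 0 := by
    refine ae_eq_zero_of_integral_contDiff_smul_eq_zero ?_ fun ψ hψ hψc => key ψ hψ hψc e
    exact ((memLp_volume (Lp.memLp v.grad)).inner_const e).locallyIntegrable (by norm_num)
  refine Lp.ext ?_
  have hall : ∀ᵐ y, ∀ i : Fin N, inner ℝ (v.grad y) (EuclideanSpace.basisFun (Fin N) ℝ i) = 0 :=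
    ae_all_iff.2 fun i => hzero _
  filter_upwards [measK_absolutelyContinuous.ae_le hall,
    Lp.coeFn_zero (Sp N) 2 (measK N)] with y hy h0
  rw [h0]
  ext i
  simpa [EuclideanSpace.inner_single_right] using hy i

/-! ### Weak convergence in Hilbert spaces. -/

section Weak

variable {H G : Type*} [NormedAddCommGroup H] [InnerProductSpace ℝ H]
  [NormedAddCommGroup G] [InnerProductSpace ℝ G]

/-- Weak convergence of a sequence in a real Hilbert space. -/
def WeakTendsto (u : ℕ → H) (v : H) : Prop :=
  ∀ w : H, Tendsto (fun n => inner ℝ (u n) w) atTop (𝓝 (inner ℝ v w))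

lemma WeakTendsto.unique {u : ℕ → H} {v v' : H} (h : WeakTendsto u v) (h' : WeakTendsto u v') :
    v = v' :=
  ext_inner_right ℝ fun w => tendsto_nhds_unique (h w) (h' w)

lemma WeakTendsto.comp {u : ℕ → H} {v : H} (h : WeakTendsto u v) {ns : ℕ → ℕ}
    (hns : Tendsto ns atTop atTop) : WeakTendsto (fun n => u (ns n)) v :=
  fun w => (h w).comp hns

variable [CompleteSpace H] [CompleteSpace G]

lemma WeakTendsto.clm {u : ℕ → H} {v : H} (h : WeakTendsto u v) (ℓ : H →L[ℝ] ℝ) :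
    Tendsto (fun n => ℓ (u n)) atTop (𝓝 (ℓ v)) := by
  have := h ((InnerProductSpace.toDual ℝ H).symm ℓ)
  have e (x : H) : inner ℝ x ((InnerProductSpace.toDual ℝ H).symm ℓ) = ℓ x := by
    rw [real_inner_comm, InnerProductSpace.toDual_symm_apply]
  simpa only [e] using this

lemma WeakTendsto.map {u : ℕ → H} {v : H} (h : WeakTendsto u v) (T : H →L[ℝ] G) :
    WeakTendsto (fun n => T (u n)) (T v) := by
  intro w
  simpa [ContinuousLinearMap.adjoint_inner_right] using h (T.adjoint w)

lemma exists_weakTendsto_subseq [TopologicalSpace.SeparableSpace H] {u : ℕ → H} {M : ℝ}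
    (hu : ∀ n, ‖u n‖ ≤ M) :
    ∃ (v : H) (ns : ℕ → ℕ), StrictMono ns ∧ WeakTendsto (fun n => u (ns n)) v := by
  let f : ℕ → WeakDual ℝ H := fun n =>
    WeakDual.toStrongDual.symm (InnerProductSpace.toDual ℝ H (u n))
  have hf (n : ℕ) : f n ∈ WeakDual.toStrongDual ⁻¹' Metric.closedBall (0 : StrongDual ℝ H) M := by
    simpa [f] using hu n
  obtain ⟨g, -, ns, hns, hg⟩ := WeakDual.isSeqCompact_closedBall ℝ H 0 M hf
  refine ⟨(InnerProductSpace.toDual ℝ H).symm (WeakDual.toStrongDual g), ns, hns, fun w => ?_⟩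
  rw [InnerProductSpace.toDual_symm_apply]
  have := ((WeakDual.eval_continuous w).tendsto g).comp hg
  exact this

/-- A bounded sequence whose image under an injective operator converges weakly converges
weakly. -/
lemma exists_weakTendsto_of_injective [TopologicalSpace.SeparableSpace H] {u : ℕ → H} {M : ℝ}
    (hu : ∀ n, ‖u n‖ ≤ M) {T : H →L[ℝ] G} (hT : Function.Injective T) {f : G}
    (hf : WeakTendsto (fun n => T (u n)) f) : ∃ v : H, T v = f ∧ WeakTendsto u v := by
  obtain ⟨v, ns, hns, hv⟩ := exists_weakTendsto_subseq hu
  have hTv : T v = f := (hv.map T).unique (hf.comp hns.tendsto_atTop)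
  -- Every subsequence has a weakly convergent further subsequence, and injectivity of `T` forces
  -- its limit to be `v`; so the whole sequence converges. This later allows one subsequence to
  -- serve all times.
  refine ⟨v, hTv, fun w => tendsto_of_subseq_tendsto fun ks hks => ?_⟩
  obtain ⟨v', ms, hms, hv'⟩ := exists_weakTendsto_subseq (u := fun n => u (ks n)) fun n => hu _
  have h' : T v' = f := (hv'.map T).unique (hf.comp (hks.comp hms.tendsto_atTop))
  have : v' = v := hT (h'.trans hTv.symm)
  exact ⟨ms, this ▸ hv' w⟩

end Weak

/-! ### Compactness of the embedding of `X` into `L²_K`. -/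

instance : SecondCountableTopology (L2K N) :=
  have : Fact ((2 : ℝ≥0∞) ≠ ⊤) := ⟨by simp⟩
  inferInstance

instance : SecondCountableTopology (X N) :=
  have : Fact ((2 : ℝ≥0∞) ≠ ⊤) := ⟨by simp⟩
  inferInstance

lemma X.norm_grad_le (v : X N) : ‖v.grad‖ ≤ ‖v‖ :=
  le_of_sq_le_sq (by nlinarith [X.norm_sq v, sq_nonneg ‖v.fn‖]) (norm_nonneg _)

lemma X.norm_fn_le (v : X N) : ‖v.fn‖ ≤ ‖v‖ :=
  le_of_sq_le_sq (by nlinarith [X.norm_sq v, sq_nonneg ‖v.grad‖]) (norm_nonneg _)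

lemma enorm_ballAvg_sq_le {r : ℝ} (hr : 0 < r) (u : L2K N) (x : Sp N) :
    ‖ballAvg r u x‖ₑ ^ 2 ≤ (volume (Metric.ball (0 : Sp N) r))⁻¹ * ‖u‖ₑ ^ 2 := by
  have hs0 : volume (Metric.ball (0 : Sp N) r) ≠ 0 := (Metric.measure_ball_pos _ _ hr).ne'
  have hs1 : volume (Metric.ball (0 : Sp N) r) ≠ ⊤ := measure_ball_lt_top.ne
  have hvol : volume (Metric.ball x r) = volume (Metric.ball (0 : Sp N) r) :=
    Measure.addHaar_ball_center _ _ _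
  let ρ : Measure (Sp N) :=
    (volume (Metric.ball (0 : Sp N) r))⁻¹ • volume.restrict (Metric.ball x r)
  have : IsProbabilityMeasure ρ := ⟨by simp [ρ, hvol, ENNReal.inv_mul_cancel hs0 hs1]⟩
  have e : ballAvg r u x = ∫ z, u z ∂ρ := by
    rw [integral_smul_measure, ENNReal.toReal_inv, smul_eq_mul]
    rfl
  rw [e, Lp.enorm_def, eLpNorm_two_sq]
  refine (enorm_integral_sq_le (Lp.stronglyMeasurable u).aestronglyMeasurable).trans ?_
  rw [lintegral_smul_measure, smul_eq_mul]
  refine mul_le_mul_right ?_ _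
  exact lintegral_mono' (Measure.restrict_le_self.trans volume_le_measK) le_rfl

/-- Outside the ball of radius `R` the moment bound gives decay `R⁻²`; inside, `K ≤ exp(R²/4)` and
`w` is compared with its averages at scale `r`. -/
lemma lintegral_enorm_sq_le_split {r R M : ℝ} (hr : 0 < r) (hR : 0 < R) (w : X N)
    (hM : ‖w.grad‖ ≤ M) :
    ∫⁻ y, ‖w.fn y‖ₑ ^ 2 ∂measK N ≤ ENNReal.ofReal (16 * M ^ 2 / R ^ 2) +
      ENNReal.ofReal (Real.exp (R ^ 2 / 4)) * (2 * (ENNReal.ofReal (r ^ 2 * M ^ 2) +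
        ∫⁻ x in Metric.ball (0 : Sp N) R, ‖ballAvg r w.fn x‖ₑ ^ 2)) := by
  have hM0 : 0 ≤ M := (norm_nonneg _).trans hM
  have hsm := Lp.stronglyMeasurable w.fn
  rw [← lintegral_add_compl _ (measurableSet_ball (x := (0 : Sp N)) (ε := R)), add_comm]
  refine add_le_add ?_ ?_
  · have h1 := X.eLpNorm_norm_mul_le w
    have h2 : ∫⁻ y, ‖‖y‖ * w.fn y‖ₑ ^ 2 ∂measK N ≤ ENNReal.ofReal (16 * M ^ 2) := by
      rw [← eLpNorm_two_sq]
      refine (pow_le_pow_left' h1 2).trans ?_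
      rw [ENNReal.coe_ofNat, mul_pow, ← ENNReal.ofReal_pow (norm_nonneg _),
        ENNReal.ofReal_mul (by norm_num)]
      gcongr
      norm_num
    calc ∫⁻ y in (Metric.ball (0 : Sp N) R)ᶜ, ‖w.fn y‖ₑ ^ 2 ∂measK N
        ≤ ∫⁻ y in (Metric.ball (0 : Sp N) R)ᶜ,
          ENNReal.ofReal ((R ^ 2)⁻¹) * ‖‖y‖ * w.fn y‖ₑ ^ 2 ∂measK N := by
          refine setLIntegral_mono' measurableSet_ball.compl fun y hy => ?_
          have hy' : R ≤ ‖y‖ := by simpa using hy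
          simp only [← ofReal_norm]
          rw [← ENNReal.ofReal_pow (norm_nonneg _), ← ENNReal.ofReal_pow (norm_nonneg _),
            ← ENNReal.ofReal_mul (by positivity)]
          refine ENNReal.ofReal_le_ofReal ?_
          rw [norm_mul, norm_norm, mul_pow, ← mul_assoc]
          refine le_mul_of_one_le_left (by positivity) ?_
          rw [inv_mul_eq_div, one_le_div (by positivity)]
          gcongr
      _ ≤ ∫⁻ y, ENNReal.ofReal ((R ^ 2)⁻¹) * ‖‖y‖ * w.fn y‖ₑ ^ 2 ∂measK N :=
          setLIntegral_le_lintegral _ _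
      _ = ENNReal.ofReal ((R ^ 2)⁻¹) * ∫⁻ y, ‖‖y‖ * w.fn y‖ₑ ^ 2 ∂measK N :=
          lintegral_const_mul' _ _ (by simp)
      _ ≤ ENNReal.ofReal ((R ^ 2)⁻¹) * ENNReal.ofReal (16 * M ^ 2) := by gcongr
      _ = _ := by
          rw [← ENNReal.ofReal_mul (by positivity)]
          congr 1
          field_simp
  · have hrestr : (measK N).restrict (Metric.ball 0 R) ≤
        ENNReal.ofReal (Real.exp (R ^ 2 / 4)) • volume.restrict (Metric.ball (0 : Sp N) R) := by
      rw [measK, restrict_withDensity measurableSet_ball, ← withDensity_const]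
      refine withDensity_mono ?_
      filter_upwards [ae_restrict_mem measurableSet_ball] with y hy
      refine ENNReal.ofReal_le_ofReal (Real.exp_le_exp.2 ?_)
      have : ‖y‖ < R := by simpa using hy
      gcongr
    refine (lintegral_mono' hrestr le_rfl).trans ?_
    rw [lintegral_smul_measure, smul_eq_mul]
    refine mul_le_mul_right ?_ _
    have h1 := X.eLpNorm_sub_ballAvg_le hr w
    have h2 : ∫⁻ x in Metric.ball (0 : Sp N) R, ‖w.fn x - ballAvg r w.fn x‖ₑ ^ 2 ≤
        ENNReal.ofReal (r ^ 2 * M ^ 2) := by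
      refine (setLIntegral_le_lintegral _ _).trans ?_
      rw [← eLpNorm_two_sq]
      refine (pow_le_pow_left' h1 2).trans ?_
      rw [mul_pow, ← ENNReal.ofReal_pow (norm_nonneg _), ENNReal.ofReal_mul (by positivity),
        ENNReal.ofReal_pow hr.le]
      gcongr
      rfl
    have h3 (x : Sp N) : ‖w.fn x‖ₑ ^ 2 ≤ 2 * ‖w.fn x - ballAvg r w.fn x‖ₑ ^ 2 +
        2 * ‖ballAvg r w.fn x‖ₑ ^ 2 := by
      have h := ENNReal.rpow_add_le_mul_rpow_add_rpow ‖w.fn x - ballAvg r w.fn x‖ₑ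
        ‖ballAvg r w.fn x‖ₑ (p := 2) (by norm_num)
      norm_num at h
      rw [mul_add] at h
      refine le_trans (pow_le_pow_left' ?_ 2) h
      simpa using enorm_add_le (w.fn x - ballAvg r w.fn x) (ballAvg r w.fn x)
    refine (lintegral_mono h3).trans ?_
    have hav := (stronglyMeasurable_ballAvg r hsm)
    rw [lintegral_add_right _ ((hav.enorm.pow_const 2).const_mul 2),
      lintegral_const_mul' _ _ (by simp), lintegral_const_mul' _ _ (by simp), mul_add]
    gcongr

/-- The embedding of `X` into `L²_K` is completely continuous. -/
lemma tendsto_fn_of_weakTendsto {u : ℕ → X N} {v : X N} {M : ℝ} (hu : ∀ n, ‖u n‖ ≤ M)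
    (h : WeakTendsto u v) : Tendsto (fun n => (u n).fn) atTop (𝓝 v.fn) := by
  let w : ℕ → X N := fun n => u n - v
  set M' := M + ‖v‖
  have hw (n : ℕ) : ‖w n‖ ≤ M' := (norm_sub_le _ _).trans (add_le_add_left (hu n) _)
  have hlim {r R : ℝ} (hr : 0 < r) : Tendsto (fun n => ∫⁻ x in Metric.ball (0 : Sp N) R,
      ‖ballAvg r (w n).fn x‖ₑ ^ 2) atTop (𝓝 0) := by
    have : (0 : ℝ≥0∞) = ∫⁻ x in Metric.ball (0 : Sp N) R, 0 := by simp
    rw [this]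
    refine tendsto_lintegral_of_dominated_convergence
      (fun _ => (volume (Metric.ball (0 : Sp N) r))⁻¹ * ENNReal.ofReal M' ^ 2) (fun n => ?_)
      (fun n => Eventually.of_forall fun x => ?_) ?_ (Eventually.of_forall fun x => ?_)
    · exact (stronglyMeasurable_ballAvg r (Lp.stronglyMeasurable _)).enorm.pow_const 2
    · refine (enorm_ballAvg_sq_le hr _ x).trans ?_
      refine mul_le_mul_right (pow_le_pow_left' ?_ 2) _
      rw [← ofReal_norm]
      exact ENNReal.ofReal_le_ofReal ((X.norm_fn_le _).trans (hw n))
    · rw [setLIntegral_const]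
      refine ENNReal.mul_ne_top (ENNReal.mul_ne_top ?_ (by simp)) measure_ball_lt_top.ne
      exact ENNReal.inv_ne_top.2 (Metric.measure_ball_pos _ _ hr).ne'
    -- Ball averages are continuous functionals, so weak convergence makes them converge at every
    -- point.
    · obtain ⟨ℓ, hℓ⟩ := exists_clm_integral_ball x r
      have h1 := (h.clm (ℓ.comp (fnL N))).sub_const (ℓ v.fn)
      have h2 : Tendsto (fun n => ballAvg r (w n).fn x) atTop (𝓝 0) := by
        have h3 : Tendsto (fun n => ∫ z in Metric.ball x r, (w n).fn z) atTop (𝓝 0) := by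
          simp only [← hℓ]
          refine (h1.congr fun n => ?_).trans_eq ?_
          · simp [w, X.fn_sub, fnL_apply]
          · simp [fnL_apply]
        have h5 := h3.const_mul (volume.real (Metric.ball (0 : Sp N) r))⁻¹
        rwa [mul_zero] at h5
      have h4 := ((ENNReal.continuous_pow 2).tendsto _).comp ((continuous_enorm.tendsto _).comp h2)
      simpa [Function.comp_def] using h4
  -- The order of limits is `n → ∞`, then `r → 0`, then `R → ∞`: the factor `exp(R²/4)` must be
  -- beaten by `r` at fixed `R`.
  set L := limsup (fun n => ∫⁻ y, ‖(w n).fn y‖ₑ ^ 2 ∂measK N) atTop with hL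
  have hbd (r R : ℝ) (hr : 0 < r) (hR : 0 < R) : L ≤ ENNReal.ofReal (16 * M' ^ 2 / R ^ 2) +
      ENNReal.ofReal (Real.exp (R ^ 2 / 4)) * (2 * (ENNReal.ofReal (r ^ 2 * M' ^ 2))) := by
    have h1 := (limsup_le_limsup (Eventually.of_forall fun n => lintegral_enorm_sq_le_split hr hR (w n)
      ((X.norm_grad_le _).trans (hw n))) : L ≤ _)
    refine h1.trans_eq (Tendsto.limsup_eq ?_)
    refine Tendsto.const_add _ (ENNReal.Tendsto.const_mul (ENNReal.Tendsto.const_mul ?_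
      (Or.inr (by simp))) (Or.inr (by simp)))
    simpa using (hlim hr).const_add (ENNReal.ofReal (r ^ 2 * M' ^ 2))
  have hbd2 (R : ℝ) (hR : 0 < R) : L ≤ ENNReal.ofReal (16 * M' ^ 2 / R ^ 2) := by
    have h1 : Tendsto (fun r : ℝ => ENNReal.ofReal (16 * M' ^ 2 / R ^ 2) +
      ENNReal.ofReal (Real.exp (R ^ 2 / 4)) * (2 * (ENNReal.ofReal (r ^ 2 * M' ^ 2)))) (𝓝[>] 0)
      (𝓝 (ENNReal.ofReal (16 * M' ^ 2 / R ^ 2) + ENNReal.ofReal (Real.exp (R ^ 2 / 4)) *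
        (2 * (ENNReal.ofReal ((0 : ℝ) ^ 2 * M' ^ 2))))) := by
      refine Tendsto.const_add _ (ENNReal.Tendsto.const_mul (ENNReal.Tendsto.const_mul ?_
        (Or.inr (by simp))) (Or.inr (by simp)))
      refine ENNReal.tendsto_ofReal (Tendsto.mono_left ?_ nhdsWithin_le_nhds)
      exact (by fun_prop : Continuous fun r : ℝ => r ^ 2 * M' ^ 2).tendsto 0
    have h2 := ge_of_tendsto h1 (eventually_nhdsWithin_of_forall fun r hr => hbd r R hr hR)
    simpa using h2
  have hL0 : L = 0 := by
    have h1 : Tendsto (fun R : ℝ => ENNReal.ofReal (16 * M' ^ 2 / R ^ 2)) atTop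
        (𝓝 (ENNReal.ofReal 0)) :=
      ENNReal.tendsto_ofReal (tendsto_const_nhds.div_atTop (tendsto_pow_atTop two_ne_zero))
    have h2 := ge_of_tendsto h1 ((eventually_gt_atTop 0).mono fun R hR => hbd2 R hR)
    simpa using h2
  have hT : Tendsto (fun n => ∫⁻ y, ‖(w n).fn y‖ₑ ^ 2 ∂measK N) atTop (𝓝 0) :=
    tendsto_of_le_liminf_of_limsup_le bot_le hL0.le
  have hT2 : Tendsto (fun n => ‖(w n).fn‖ₑ) atTop (𝓝 0) := by
    have h3 := ((ENNReal.continuous_rpow_const (y := (1 / 2 : ℝ))).tendsto 0).comp hT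
    rw [ENNReal.zero_rpow_of_pos (by norm_num)] at h3
    refine h3.congr fun n => ?_
    simp only [Function.comp_apply]
    rw [← eLpNorm_two_sq, ← Lp.enorm_def, ← ENNReal.rpow_natCast, ← ENNReal.rpow_mul]
    norm_num
  rw [tendsto_iff_norm_sub_tendsto_zero]
  have h4 := (ENNReal.tendsto_toReal ENNReal.zero_ne_top).comp hT2
  refine (h4.congr fun n => ?_).trans_eq (by simp)
  simp [w, X.fn_sub]

/-! ### Elementary inequalities for powers, and a convergence criterion for integrals. -/

section Pointwise

/-- Either `|a| ≤ η|b|`, and `(1+η)^q` is close to `1`, or `b` is absorbed by `a` at the cost of a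
large constant. This gives the domination required by the Brezis–Lieb argument. -/
lemma exists_abs_add_rpow_le {q : ℝ} (hq : 0 < q) {δ : ℝ} (hδ : 0 < δ) :
    ∃ C : ℝ, 0 ≤ C ∧ ∀ a b : ℝ, |a + b| ^ q ≤ (1 + δ) * |b| ^ q + C * |a| ^ q := by
  have hcont : Tendsto (fun η : ℝ => (1 + η) ^ q) (𝓝[>] 0) (𝓝 1) := by
    have : ContinuousAt (fun η : ℝ => (1 + η) ^ q) 0 :=
      ContinuousAt.rpow_const (by fun_prop) (Or.inr hq.le)
    have h := this.tendsto
    simp only [add_zero, Real.one_rpow] at h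
    exact h.mono_left nhdsWithin_le_nhds
  obtain ⟨η, hη, hη0⟩ := ((hcont.eventually (gt_mem_nhds (by linarith : (1 : ℝ) < 1 + δ))).and
    self_mem_nhdsWithin).exists
  have hη0 : 0 < η := hη0
  refine ⟨(1 + η⁻¹) ^ q, by positivity, fun a b => ?_⟩
  rcases le_total |a| (η * |b|) with h | h
  · have h1 : |a + b| ≤ (1 + η) * |b| := (abs_add_le a b).trans (by linarith)
    calc |a + b| ^ q ≤ ((1 + η) * |b|) ^ q := Real.rpow_le_rpow (abs_nonneg _) h1 hq.le
      _ = (1 + η) ^ q * |b| ^ q := Real.mul_rpow (by positivity) (abs_nonneg _)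
      _ ≤ (1 + δ) * |b| ^ q := by gcongr
      _ ≤ _ := le_add_of_nonneg_right (by positivity)
  · have h2 : |b| ≤ η⁻¹ * |a| := by rwa [inv_mul_eq_div, le_div_iff₀ hη0, mul_comm]
    have h1 : |a + b| ≤ (1 + η⁻¹) * |a| := (abs_add_le a b).trans (by linarith)
    calc |a + b| ^ q ≤ ((1 + η⁻¹) * |a|) ^ q := Real.rpow_le_rpow (abs_nonneg _) h1 hq.le
      _ = (1 + η⁻¹) ^ q * |a| ^ q := Real.mul_rpow (by positivity) (abs_nonneg _)
      _ ≤ _ := le_add_of_nonneg_left (by positivity)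

lemma abs_rpow_sub_two_mul_self {q : ℝ} (hq : 1 < q) (a : ℝ) :
    |(|a| ^ (q - 2) * a)| = |a| ^ (q - 1) := by
  rcases eq_or_ne a 0 with rfl | ha
  · simp [Real.zero_rpow (by linarith : q - 1 ≠ 0)]
  · have : 0 < |a| := abs_pos.2 ha
    rw [abs_mul, abs_of_pos (Real.rpow_pos_of_pos this _)]
    nth_rewrite 2 [← Real.rpow_one |a|]
    rw [← Real.rpow_add this]
    congr 1
    ring

/-- Young's inequality with non-optimal constants, by comparing `y` with `δ x`. -/
lemma rpow_sub_one_mul_le {q : ℝ} (hq : 1 < q) {δ : ℝ} (hδ : 0 < δ) {x y : ℝ} (hx : 0 ≤ x)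
    (hy : 0 ≤ y) : x ^ (q - 1) * y ≤ δ * x ^ q + (δ⁻¹) ^ (q - 1) * y ^ q := by
  have e {z : ℝ} (hz : 0 ≤ z) : z ^ (q - 1) * z = z ^ q := by
    nth_rewrite 2 [← Real.rpow_one z]
    rw [← Real.rpow_add_of_nonneg hz (by linarith) zero_le_one, sub_add_cancel]
  rcases le_total y (δ * x) with h | h
  · calc x ^ (q - 1) * y ≤ x ^ (q - 1) * (δ * x) := by gcongr
      _ = δ * x ^ q := by rw [← e hx]; ring
      _ ≤ _ := le_add_of_nonneg_right (by positivity)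
  · have h2 : x ≤ δ⁻¹ * y := by rwa [inv_mul_eq_div, le_div_iff₀ hδ, mul_comm]
    calc x ^ (q - 1) * y ≤ (δ⁻¹ * y) ^ (q - 1) * y := by
          gcongr
      _ = (δ⁻¹) ^ (q - 1) * y ^ q := by
          rw [Real.mul_rpow (by positivity) hy, mul_assoc, e hy]
      _ ≤ _ := le_add_of_nonneg_left (by positivity)

/-- The tangent line inequality for `t ↦ |t| ^ q`. -/
lemma abs_rpow_add_le {q : ℝ} (hq : 1 < q) (a b : ℝ) :
    |a| ^ q + q * (|a| ^ (q - 2) * a * b) ≤ |a + b| ^ q := by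
  have hq0 : 0 < q := by linarith
  -- Weighted AM–GM with weights `(q-1)/q` and `1/q` is Young's inequality for `|a|^(q-1) |a+b|`.
  have hy := Real.geom_mean_le_arith_mean2_weighted (w₁ := (q - 1) / q) (w₂ := 1 / q)
    (p₁ := |a| ^ q) (p₂ := |a + b| ^ q) (div_nonneg (by linarith) hq0.le) (by positivity)
    (by positivity) (by positivity) (by field_simp; ring)
  rw [← Real.rpow_mul (abs_nonneg _), ← Real.rpow_mul (abs_nonneg _),
    mul_div_cancel₀ _ hq0.ne', mul_one_div_cancel hq0.ne', Real.rpow_one] at hy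
  have h1 : |a| ^ (q - 2) * a * (a + b) ≤ |a| ^ (q - 1) * |a + b| := by
    rw [← abs_rpow_sub_two_mul_self hq, ← abs_mul]
    exact le_abs_self _
  have h2 : |a| ^ (q - 2) * a * a = |a| ^ q := by
    rcases eq_or_ne a 0 with rfl | ha
    · simp [Real.zero_rpow hq0.ne']
    · rw [mul_assoc, ← abs_mul_abs_self, ← pow_two, ← Real.rpow_natCast,
        ← Real.rpow_add (abs_pos.2 ha)]
      congr 1
      push_cast
      ring
  have h3 : q * (|a| ^ (q - 1) * |a + b|) ≤ (q - 1) * |a| ^ q + |a + b| ^ q := by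
    have := mul_le_mul_of_nonneg_left hy hq0.le
    refine this.trans_eq ?_
    field_simp
  have h4 := mul_le_mul_of_nonneg_left h1 hq0.le
  rw [mul_add, h2] at h4
  linarith

end Pointwise

/-- A one-sided version of the Brezis–Lieb argument. -/
lemma eventually_integral_le {α : Type*} [MeasurableSpace α] {ν : Measure α} {G W : ℕ → α → ℝ}
    {M : ℝ} (hG : ∀ n, Integrable (G n) ν) (hW : ∀ n, Integrable (W n) ν)
    (hW0 : ∀ n y, 0 ≤ W n y) (hWM : ∀ n, ∫ y, W n y ∂ν ≤ M)
    (hGW : ∀ δ > 0, ∃ H : α → ℝ, Integrable H ν ∧ ∀ n y, G n y ≤ δ * W n y + H y)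
    (hlim : ∀ᵐ y ∂ν, Tendsto (fun n => G n y) atTop (𝓝 0)) {ε : ℝ} (hε : 0 < ε) :
    ∀ᶠ n in atTop, ∫ y, G n y ∂ν ≤ ε := by
  have hM : 0 ≤ M := (integral_nonneg (hW0 0)).trans (hWM 0)
  set δ := ε / (2 * (M + 1)) with hδ
  have hδ0 : 0 < δ := by positivity
  obtain ⟨H, hH, hle⟩ := hGW δ hδ0
  -- The truncation `(G_n - δ W_n)⁺` is dominated by `|H|` and tends to zero; the discarded part
  -- costs at most `δ M ≤ ε/2`.
  let F : ℕ → α → ℝ := fun n y => max (G n y - δ * W n y) 0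
  have hFi (n : ℕ) : Integrable (F n) ν := ((hG n).sub ((hW n).const_mul δ)).pos_part
  have hF : Tendsto (fun n => ∫ y, F n y ∂ν) atTop (𝓝 0) := by
    have h0 : (0 : ℝ) = ∫ _, (0 : ℝ) ∂ν := by simp
    rw [h0]
    refine tendsto_integral_of_dominated_convergence (fun y => |H y|)
      (fun n => (hFi n).aestronglyMeasurable) hH.abs (fun n => Eventually.of_forall fun y => ?_) ?_
    · rw [Real.norm_of_nonneg (le_max_right _ _)]
      refine max_le ?_ (abs_nonneg _)
      have := hle n y
      linarith [le_abs_self (H y)]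
    · filter_upwards [hlim] with y hy
      refine squeeze_zero (fun n => le_max_right _ _) (fun n => ?_) (by simpa using hy.abs)
      refine max_le ?_ (abs_nonneg _)
      linarith [le_abs_self (G n y), mul_nonneg hδ0.le (hW0 n y)]
  filter_upwards [hF.eventually (gt_mem_nhds (by positivity : 0 < ε / 2))] with n hn
  have h1 : ∫ y, G n y ∂ν ≤ ∫ y, (F n y + δ * W n y) ∂ν :=
    integral_mono (hG n) ((hFi n).add ((hW n).const_mul δ)) fun y => by
      have := le_max_left (G n y - δ * W n y) 0
      simp only [F]
      linarith
  rw [integral_add (hFi n) ((hW n).const_mul δ), integral_const_mul] at h1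
  have h2 : δ * ∫ y, W n y ∂ν ≤ ε / 2 := by
    calc δ * ∫ y, W n y ∂ν ≤ δ * (M + 1) := by gcongr; linarith [hWM n]
      _ = ε / 2 := by rw [hδ]; field_simp
  linarith

/-! ### The functionals `A`, `B` and their behaviour under weak convergence. -/

section Functionals

lemma X.memLp_hardy (hN : 3 ≤ N) (v : X N) : MemLp (fun y => ‖y‖⁻¹ * v.fn y) 2 (measK N) :=
  ⟨measurable_norm.inv.aestronglyMeasurable.mul (Lp.aestronglyMeasurable v.fn),
    (X.hardy hN v).trans_lt (ENNReal.mul_lt_top (by simp) (by simp))⟩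

/-- The map `v ↦ v / |y|` from `X` to `L²_K`. -/
def hardyL (hN : 3 ≤ N) : X N →L[ℝ] L2K N :=
  LinearMap.mkContinuous
    { toFun := fun v => (X.memLp_hardy hN v).toLp
      map_add' := fun v w => by
        refine Lp.ext ?_
        filter_upwards [(X.memLp_hardy hN (v + w)).coeFn_toLp, (X.memLp_hardy hN v).coeFn_toLp,
          (X.memLp_hardy hN w).coeFn_toLp, Lp.coeFn_add v.fn w.fn,
          Lp.coeFn_add (X.memLp_hardy hN v).toLp (X.memLp_hardy hN w).toLp] with y h1 h2 h3 h4 h5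
        rw [h1, h5, Pi.add_apply, h2, h3, X.fn_add, h4, Pi.add_apply]
        ring
      map_smul' := fun c v => by
        refine Lp.ext ?_
        filter_upwards [(X.memLp_hardy hN (c • v)).coeFn_toLp, (X.memLp_hardy hN v).coeFn_toLp,
          Lp.coeFn_smul c v.fn, Lp.coeFn_smul c (X.memLp_hardy hN v).toLp] with y h1 h2 h3 h4
        simp only [RingHom.id_apply]
        rw [h1, h4, Pi.smul_apply, h2, X.fn_smul, h3, Pi.smul_apply, smul_eq_mul, smul_eq_mul]
        ring } (2 / (N - 2)) fun v => by
    have hN' : (3 : ℝ) ≤ N := by exact_mod_cast hN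
    have h0 : (0 : ℝ) ≤ 2 / (N - 2) := div_nonneg (by norm_num) (by linarith)
    have h1 := X.hardy hN v
    simp only [LinearMap.coe_mk, AddHom.coe_mk]
    rw [Lp.norm_toLp]
    refine (ENNReal.toReal_mono (ENNReal.mul_ne_top (by simp) (by simp)) h1).trans ?_
    rw [ENNReal.toReal_mul, ENNReal.toReal_ofReal (norm_nonneg _), ENNReal.coe_toReal,
      Real.coe_toNNReal _ h0]
    exact mul_le_mul_of_nonneg_left (X.norm_grad_le v) h0

lemma hardyL_coeFn (hN : 3 ≤ N) (v : X N) :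
    hardyL hN v =ᵐ[measK N] fun y => ‖y‖⁻¹ * v.fn y := (X.memLp_hardy hN v).coeFn_toLp

lemma norm_hardyL_le (hN : 3 ≤ N) (v : X N) : ‖hardyL hN v‖ ≤ 2 / (N - 2) * ‖v.grad‖ := by
  have hN' : (3 : ℝ) ≤ N := by exact_mod_cast hN
  have h0 : (0 : ℝ) ≤ 2 / (N - 2) := div_nonneg (by norm_num) (by linarith)
  have h1 := X.hardy hN v
  change ‖(X.memLp_hardy hN v).toLp‖ ≤ _
  rw [Lp.norm_toLp]
  refine (ENNReal.toReal_mono (ENNReal.mul_ne_top (by simp) (by simp)) h1).trans_eq ?_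
  rw [ENNReal.toReal_mul, ENNReal.toReal_ofReal (norm_nonneg _), ENNReal.coe_toReal,
    Real.coe_toNNReal _ h0]

/-- The bilinear form whose quadratic form is `A`. -/
def formA (hN : 3 ≤ N) (μ : ℝ) (v w : X N) : ℝ :=
  inner ℝ (gradL N v) (gradL N w) - μ * inner ℝ (hardyL hN v) (hardyL hN w) -
    beta N * inner ℝ (fnL N v) (fnL N w)

lemma norm_sq_eq_integral {E : Type*} [NormedAddCommGroup E] [InnerProductSpace ℝ E] {α : Type*}
    [MeasurableSpace α] {ν : Measure α} (f : Lp E 2 ν) : ‖f‖ ^ 2 = ∫ y, ‖f y‖ ^ 2 ∂ν := by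
  rw [← real_inner_self_eq_norm_sq, L2.inner_def]
  simp only [real_inner_self_eq_norm_sq]

lemma funA_eq (hN : 3 ≤ N) (μ : ℝ) (v : X N) : funA N μ v = formA hN μ v v := by
  have i1 := (Lp.memLp v.grad).integrable_norm_pow two_ne_zero
  have i2 := (Lp.memLp (hardyL hN v)).integrable_norm_pow two_ne_zero
  have i3 := (Lp.memLp v.fn).integrable_norm_pow two_ne_zero
  rw [formA, real_inner_self_eq_norm_sq, real_inner_self_eq_norm_sq, real_inner_self_eq_norm_sq,
    norm_sq_eq_integral, norm_sq_eq_integral, norm_sq_eq_integral, ← integral_const_mul,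
    ← integral_const_mul, ← integral_sub, ← integral_sub]
  · refine integral_congr_ae ?_
    filter_upwards [hardyL_coeFn hN v] with y hy
    rw [hy, norm_mul, norm_inv, norm_norm, mul_pow, inv_pow, Real.norm_eq_abs, fnL_apply,
      gradL_apply]
    simp only [div_eq_inv_mul]
    rfl
  · exact i1.sub (i2.const_mul μ)
  · exact i3.const_mul _
  · exact i1
  · exact i2.const_mul μ

/-- The Hardy term takes at most `1/2` of the Dirichlet integral, as `μ` is at most half the Hardy
constant `(N-2)²/4`. The `β` term takes at most `(N-2)/(2N) = 1/2 - 1/N` by Poincaré. A fraction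
`1/N` remains. -/
lemma formA_coercive (hN : 3 ≤ N) {μ : ℝ} (hμ : μ ≤ ((N : ℝ) - 2) ^ 2 / 8)
    (v : X N) : ‖v.grad‖ ^ 2 / N ≤ formA hN μ v v := by
  have hN' : (3 : ℝ) ≤ N := by exact_mod_cast hN
  have hN2 : (0 : ℝ) < N - 2 := by linarith
  have h1 : μ * ‖hardyL hN v‖ ^ 2 ≤ ‖v.grad‖ ^ 2 / 2 := by
    calc μ * ‖hardyL hN v‖ ^ 2 ≤ ((N : ℝ) - 2) ^ 2 / 8 * (2 / (N - 2) * ‖v.grad‖) ^ 2 := by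
          gcongr
          exact norm_hardyL_le hN v
      _ = _ := by field_simp; ring
  have h2 := X.poincare v
  have h3 : beta N * ‖v.fn‖ ^ 2 ≤ (N - 2) / (2 * N) * ‖v.grad‖ ^ 2 := by
    calc beta N * ‖v.fn‖ ^ 2 = (N - 2) / (2 * N) * (N / 2 * ‖v.fn‖ ^ 2) := by
          rw [beta]; field_simp; norm_num
      _ ≤ _ := by gcongr
  rw [formA, real_inner_self_eq_norm_sq, real_inner_self_eq_norm_sq, real_inner_self_eq_norm_sq,
    fnL_apply, gradL_apply]
  have h4 : ‖v.grad‖ ^ 2 / N = ‖v.grad‖ ^ 2 - ‖v.grad‖ ^ 2 / 2 -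
      (N - 2) / (2 * N) * ‖v.grad‖ ^ 2 := by field_simp; ring
  linarith

lemma formA_add_self (hN : 3 ≤ N) (μ : ℝ) (v w : X N) :
    formA hN μ (v + w) (v + w) = formA hN μ v v + 2 * formA hN μ v w + formA hN μ w w := by
  simp only [formA, map_add, inner_add_left, inner_add_right]
  rw [real_inner_comm (gradL N v) (gradL N w), real_inner_comm (fnL N v) (fnL N w),
    real_inner_comm (hardyL hN v) (hardyL hN w)]
  ring

lemma formA_smul_right (hN : 3 ≤ N) (μ t : ℝ) (v w : X N) :
    formA hN μ v (t • w) = t * formA hN μ v w := by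
  simp only [formA, map_smul, inner_smul_right]
  ring

lemma formA_smul_self (hN : 3 ≤ N) (μ t : ℝ) (v : X N) :
    formA hN μ (t • v) (t • v) = t ^ 2 * formA hN μ v v := by
  simp only [formA, map_smul, inner_smul_right, inner_smul_left]
  simp only [conj_trivial]
  ring

lemma formA_comm (hN : 3 ≤ N) (μ : ℝ) (v w : X N) : formA hN μ v w = formA hN μ w v := by
  rw [formA, formA, real_inner_comm (gradL N v) (gradL N w), real_inner_comm (fnL N v) (fnL N w),
    real_inner_comm (hardyL hN v) (hardyL hN w)]

lemma formA_sub_left (hN : 3 ≤ N) (μ : ℝ) (v v' w : X N) :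
    formA hN μ (v - v') w = formA hN μ v w - formA hN μ v' w := by
  simp only [formA, map_sub, inner_sub_left]
  ring

lemma formA_add_smul_self (hN : 3 ≤ N) (μ t : ℝ) (v w : X N) :
    formA hN μ (v + t • w) (v + t • w) =
      formA hN μ v v + 2 * (t * formA hN μ v w) + t ^ 2 * formA hN μ w w := by
  rw [formA_add_self, formA_smul_right, formA_smul_self]

lemma WeakTendsto.formA {u : ℕ → X N} {v : X N} (h : WeakTendsto u v) (hN : 3 ≤ N) (μ : ℝ)
    (w : X N) : Tendsto (fun n => HardyHeat.formA hN μ (u n) w) atTop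
      (𝓝 (HardyHeat.formA hN μ v w)) :=
  (((h.map (gradL N)) _).sub (((h.map (hardyL hN)) _).const_mul μ)).sub
    (((h.map (fnL N)) _).const_mul _)

lemma X.memLp_critExp (hN : 3 ≤ N) (v : X N) :
    MemLp v.fn (ENNReal.ofReal (critExp N)) (measK N) := by
  obtain ⟨C, hC⟩ := X.exists_sobolev hN
  exact ⟨Lp.aestronglyMeasurable _, (hC v).trans_lt (ENNReal.mul_lt_top (by simp) (by simp))⟩

lemma X.integrable_abs_rpow (hN : 3 ≤ N) (v : X N) :
    Integrable (fun y => |v.fn y| ^ critExp N) (measK N) := by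
  have hq := two_lt_critExp hN
  have := (X.memLp_critExp hN v).integrable_norm_rpow (by simp; linarith) (by simp)
  simpa [ENNReal.toReal_ofReal (by linarith : 0 ≤ critExp N)] using this

lemma exists_funB_le (hN : 3 ≤ N) : ∃ C : ℝ, 0 ≤ C ∧ ∀ (v : X N) (M : ℝ), ‖v‖ ≤ M →
    funB N v ≤ (C * M) ^ critExp N := by
  have hq := two_lt_critExp hN
  obtain ⟨C, hC⟩ := X.exists_sobolev hN
  refine ⟨C, C.2, fun v M hM => ?_⟩
  have hq0 : ENNReal.ofReal (critExp N) ≠ 0 := by simp; linarith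
  have h1 := hC v
  rw [(X.memLp_critExp hN v).eLpNorm_eq_integral_rpow_norm hq0 (by simp),
    ENNReal.toReal_ofReal (by linarith)] at h1
  have h2 : (∫ y, |v.fn y| ^ critExp N ∂measK N) ^ (critExp N)⁻¹ ≤ C * M := by
    have h3 := ENNReal.toReal_mono (ENNReal.mul_ne_top (by simp) (by simp)) h1
    rw [ENNReal.toReal_ofReal (by positivity), ENNReal.toReal_mul, ENNReal.coe_toReal,
      ENNReal.toReal_ofReal (norm_nonneg _)] at h3
    exact h3.trans (mul_le_mul_of_nonneg_left ((X.norm_grad_le v).trans hM) C.2)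
  have hB : 0 ≤ ∫ y, |v.fn y| ^ critExp N ∂measK N := integral_nonneg fun y => by positivity
  have h4 := Real.rpow_le_rpow (by positivity) h2 (by linarith : 0 ≤ critExp N)
  rwa [← Real.rpow_mul hB, inv_mul_cancel₀ (by linarith), Real.rpow_one] at h4

lemma funB_nonneg (v : X N) : 0 ≤ funB N v := integral_nonneg fun y => by positivity

lemma funB_smul {t : ℝ} (ht : 0 ≤ t) (v : X N) : funB N (t • v) = t ^ critExp N * funB N v := by
  rw [funB, funB, ← integral_const_mul]
  refine integral_congr_ae ?_
  rw [X.fn_smul]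
  filter_upwards [Lp.coeFn_smul t v.fn] with y hy
  rw [hy, Pi.smul_apply, smul_eq_mul, abs_mul, abs_of_nonneg ht, Real.mul_rpow ht (abs_nonneg _)]

lemma funB_pos (hN : 3 ≤ N) {v : X N} (hv : v ≠ 0) : 0 < funB N v := by
  have hq := two_lt_critExp hN
  refine (funB_nonneg v).lt_of_ne' fun h => hv (fnL_injective ?_)
  rw [map_zero, fnL_apply]
  rw [funB, integral_eq_zero_iff_of_nonneg (fun y => by positivity)
    (X.integrable_abs_rpow hN v)] at h
  refine Lp.ext ?_
  filter_upwards [h, Lp.coeFn_zero ℝ 2 (measK N)] with y hy h0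
  rw [h0]
  have hyz : |v.fn y| ^ critExp N = 0 := hy
  rw [Real.rpow_eq_zero (abs_nonneg _) (by linarith)] at hyz
  simpa using hyz

/-- The pairing `(|v|^{p-1} v, w)_K`. -/
def nlPairing (N : ℕ) (v w : X N) : ℝ :=
  ∫ y, |v.fn y| ^ (critExp N - 2) * v.fn y * w.fn y ∂measK N

lemma integrable_nlPairing (hN : 3 ≤ N) (v w : X N) :
    Integrable (fun y => |v.fn y| ^ (critExp N - 2) * v.fn y * w.fn y) (measK N) := by
  have hq := two_lt_critExp hN
  refine ((X.integrable_abs_rpow hN v).add (X.integrable_abs_rpow hN w)).mono' ?_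
    (Eventually.of_forall fun y => ?_)
  · have h1 := (Lp.stronglyMeasurable v.fn).measurable
    have h2 := (Lp.stronglyMeasurable w.fn).measurable
    exact (((h1.norm.pow_const _).mul h1).mul h2).aestronglyMeasurable
  · rw [Real.norm_eq_abs, abs_mul, abs_rpow_sub_two_mul_self (by linarith)]
    simpa using rpow_sub_one_mul_le (by linarith : 1 < critExp N) one_pos (abs_nonneg (v.fn y))
      (abs_nonneg (w.fn y))

/-- With this identity the gradient terms cancel and the weak equation reads `(v_s, w) = nlPairing v
w - formA v w`. -/
lemma rhsPairing_eq (hN : 3 ≤ N) (μ : ℝ) (v w : X N) :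
    rhsPairing N μ v w = nlPairing N v w + inner ℝ v.grad w.grad - formA hN μ v w := by
  have i1 := L2.integrable_inner (𝕜 := ℝ) (hardyL hN v) (hardyL hN w)
  have i2 := L2.integrable_inner (𝕜 := ℝ) v.fn w.fn
  have hadd := integral_add (integrable_nlPairing hN v w)
    ((i1.const_mul μ).add (i2.const_mul (beta N)))
  simp only [Pi.add_apply] at hadd
  rw [formA, fnL_apply, fnL_apply, gradL_apply, gradL_apply, sub_sub, add_sub_assoc,
    sub_sub_cancel, L2.inner_def, L2.inner_def (f := v.fn), ← integral_const_mul,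
    ← integral_const_mul, nlPairing, ← integral_add (i1.const_mul μ) (i2.const_mul _),
    ← hadd]
  refine integral_congr_ae ?_
  filter_upwards [hardyL_coeFn hN v, hardyL_coeFn hN w] with y h1 h2
  rw [h1, h2, show expP N - 1 = critExp N - 2 by rw [expP]; ring]
  simp only [RCLike.inner_apply, conj_trivial, div_eq_mul_inv]
  ring

lemma energy_eq (hN : 3 ≤ N) (μ : ℝ) (v : X N) :
    energy N μ v = formA hN μ v v / N + funD N μ v / critExp N := by
  have hq := two_lt_critExp hN
  have h := critExp_inv hN
  rw [energy, funD, funA_eq hN, one_div, one_div, div_eq_mul_inv, div_eq_mul_inv, h]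
  ring

lemma exists_ae_subseq {u : ℕ → X N} {v : X N} {M : ℝ} (hu : ∀ n, ‖u n‖ ≤ M)
    (h : WeakTendsto u v) : ∃ ns : ℕ → ℕ, StrictMono ns ∧
      ∀ᵐ y ∂measK N, Tendsto (fun n => (u (ns n)).fn y) atTop (𝓝 (v.fn y)) := by
  have h1 := tendsto_fn_of_weakTendsto hu h
  rw [Lp.tendsto_Lp_iff_tendsto_eLpNorm'] at h1
  exact (tendstoInMeasure_of_tendsto_eLpNorm (by simp) (fun n => Lp.aestronglyMeasurable _)
    (Lp.aestronglyMeasurable v.fn) h1).exists_seq_tendsto_ae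

lemma tendsto_nlPairing (hN : 3 ≤ N) {u : ℕ → X N} {v : X N} {M : ℝ} (hu : ∀ n, ‖u n‖ ≤ M)
    (h : WeakTendsto u v) (w : X N) :
    Tendsto (fun n => nlPairing N (u n) w) atTop (𝓝 (nlPairing N v w)) := by
  have hq := two_lt_critExp hN
  obtain ⟨C, hC0, hC⟩ := exists_funB_le hN
  refine tendsto_of_subseq_tendsto fun ks hks => ?_
  obtain ⟨ms, hms, hae⟩ := exists_ae_subseq (fun n => hu (ks n)) (h.comp hks)
  refine ⟨ms, ?_⟩
  set x : ℕ → X N := fun n => u (ks (ms n)) with hx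
  let P : X N → Sp N → ℝ := fun z y => |z.fn y| ^ (critExp N - 2) * z.fn y * w.fn y
  have hP (z : X N) : Integrable (P z) (measK N) := integrable_nlPairing hN z w
  have hPb (z : X N) {δ : ℝ} (hδ : 0 < δ) (y : Sp N) :
      |P z y| ≤ δ * |z.fn y| ^ critExp N + (δ⁻¹) ^ (critExp N - 1) * |w.fn y| ^ critExp N := by
    simp only [P]
    rw [abs_mul, abs_rpow_sub_two_mul_self (by linarith)]
    exact rpow_sub_one_mul_le (by linarith) hδ (abs_nonneg _) (abs_nonneg _)
  have hlim : ∀ᵐ y ∂measK N, Tendsto (fun n => P (x n) y - P v y) atTop (𝓝 0) := by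
    filter_upwards [hae] with y hy
    rw [← sub_self (P v y)]
    refine Tendsto.sub_const ?_ _
    have hc : Continuous fun t : ℝ => |t| ^ (critExp N - 2) * t * w.fn y :=
      ((continuous_abs.rpow_const fun _ => Or.inr (by linarith)).mul continuous_id).mul
        continuous_const
    exact (hc.tendsto _).comp hy
  have hW (n : ℕ) : ∫ y, |(x n).fn y| ^ critExp N ∂measK N ≤ (C * M) ^ critExp N :=
    hC _ M (hu _)
  -- The one-sided criterion is applied to the difference and to its negative; by Young, only a
  -- small multiple of the uniformly integrated `|x_n|^{2^*}` escapes domination.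
  have up := fun ε (hε : (0 : ℝ) < ε) => eventually_integral_le
    (fun n => (hP (x n)).sub (hP v)) (fun n => X.integrable_abs_rpow hN (x n))
    (fun n y => by positivity) hW (fun δ hδ => ⟨fun y => (δ⁻¹) ^ (critExp N - 1) *
      |w.fn y| ^ critExp N + |P v y|, ((X.integrable_abs_rpow hN w).const_mul _).add (hP v).abs,
      fun n y => by
        have h1 := hPb (x n) hδ y
        have h2 := le_abs_self (P (x n) y)
        have h3 := neg_abs_le (P v y)
        simp only [Pi.sub_apply]
        linarith⟩) hlim hε
  have dn := fun ε (hε : (0 : ℝ) < ε) => eventually_integral_le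
    (fun n => (hP v).sub (hP (x n))) (fun n => X.integrable_abs_rpow hN (x n))
    (fun n y => by positivity) hW (fun δ hδ => ⟨fun y => (δ⁻¹) ^ (critExp N - 1) *
      |w.fn y| ^ critExp N + |P v y|, ((X.integrable_abs_rpow hN w).const_mul _).add (hP v).abs,
      fun n y => by
        have h1 := hPb (x n) hδ y
        have h2 := neg_abs_le (P (x n) y)
        have h3 := le_abs_self (P v y)
        simp only [Pi.sub_apply]
        linarith⟩) (by
          filter_upwards [hlim] with y hy
          simpa using hy.neg) hε
  rw [Metric.tendsto_atTop']
  intro ε hε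
  obtain ⟨n, hn⟩ := ((up (ε / 2) (by positivity)).and (dn (ε / 2) (by positivity))).exists_forall_of_atTop
  refine ⟨n, fun m hm => ?_⟩
  obtain ⟨h1, h2⟩ := hn m hm.le
  simp only [Pi.sub_apply] at h1 h2
  rw [integral_sub (hP _) (hP _)] at h1 h2
  rw [Real.dist_eq, abs_lt]
  change _ < (∫ y, P (x m) y ∂measK N) - ∫ y, P v y ∂measK N ∧
    (∫ y, P (x m) y ∂measK N) - ∫ y, P v y ∂measK N < _
  constructor <;> linarith

/-- One half of the Brezis–Lieb lemma for `B`. -/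
lemma eventually_funB_le (hN : 3 ≤ N) {u : ℕ → X N} {v : X N} {M : ℝ} (hu : ∀ n, ‖u n‖ ≤ M)
    (h : WeakTendsto u v) {ε : ℝ} (hε : 0 < ε) :
    ∀ᶠ n in atTop, funB N (u n) ≤ funB N v + funB N (u n - v) + ε := by
  have hq := two_lt_critExp hN
  obtain ⟨C, hC0, hC⟩ := exists_funB_le hN
  -- A.e. convergence is available only along subsequences, so a sequence of bad indices is refined
  -- until it contradicts itself.
  by_contra hcon
  rw [not_eventually] at hcon
  obtain ⟨ks, hks, hbad⟩ := extraction_of_frequently_atTop hcon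
  obtain ⟨ms, hms, hae⟩ := exists_ae_subseq (fun n => hu (ks n)) (h.comp hks.tendsto_atTop)
  set x : ℕ → X N := fun n => u (ks (ms n)) with hx
  let Q : X N → Sp N → ℝ := fun z y => |z.fn y| ^ critExp N
  have hQ (z : X N) : Integrable (Q z) (measK N) := X.integrable_abs_rpow hN z
  have hsub : ∀ᵐ y ∂measK N, ∀ n, (x n - v).fn y = (x n).fn y - v.fn y := by
    refine ae_all_iff.2 fun n => ?_
    rw [X.fn_sub]
    exact Lp.coeFn_sub _ _
  let G : ℕ → Sp N → ℝ := fun n y =>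
    |(x n).fn y| ^ critExp N - |v.fn y| ^ critExp N - |(x n).fn y - v.fn y| ^ critExp N
  have hGe (n : ℕ) : G n =ᵐ[measK N] fun y => Q (x n) y - Q v y - Q (x n - v) y := by
    filter_upwards [hsub] with y hy
    simp only [G, Q, hy]
  have hQe (n : ℕ) : (fun y => |(x n).fn y - v.fn y| ^ critExp N) =ᵐ[measK N] Q (x n - v) := by
    filter_upwards [hsub] with y hy
    simp only [Q, hy]
  have hc : Continuous fun t : ℝ => |t| ^ critExp N :=
    continuous_abs.rpow_const fun _ => Or.inr (by linarith)
  have hev := eventually_integral_le (ν := measK N) (G := G)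
    (W := fun n y => |(x n).fn y - v.fn y| ^ critExp N) (M := (C * (M + ‖v‖)) ^ critExp N)
    (fun n => (((hQ (x n)).sub (hQ v)).sub (hQ (x n - v))).congr (hGe n).symm)
    (fun n => (hQ (x n - v)).congr (hQe n).symm) (fun n y => by positivity)
    (fun n => by
      rw [integral_congr_ae (hQe n)]
      exact hC _ _ ((norm_sub_le _ _).trans (add_le_add_left (hu _) _)))
    (fun δ hδ => by
      obtain ⟨C', hC'0, hC'⟩ := exists_abs_add_rpow_le (by linarith : 0 < critExp N) hδ
      refine ⟨fun y => C' * |v.fn y| ^ critExp N, (hQ v).const_mul _, fun n y => ?_⟩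
      have h1 := hC' (v.fn y) ((x n).fn y - v.fn y)
      rw [add_sub_cancel] at h1
      have : 0 ≤ |v.fn y| ^ critExp N := by positivity
      simp only [G]
      linarith)
    (by
      filter_upwards [hae] with y hy
      have h1 := ((hc.tendsto _).comp hy).sub_const (|v.fn y| ^ critExp N)
      have h2 := (hc.tendsto _).comp (hy.sub_const (v.fn y))
      have h3 := h1.sub h2
      simpa [Real.zero_rpow (by linarith : critExp N ≠ 0)] using h3) hε
  obtain ⟨n, hn⟩ := hev.exists
  refine hbad (ms n) ?_
  have e : ∫ y, G n y ∂measK N = funB N (x n) - funB N v - funB N (x n - v) := by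
    have h1 := integral_sub ((hQ (x n)).sub (hQ v)) (hQ (x n - v))
    simp only [Pi.sub_apply] at h1
    rw [integral_congr_ae (hGe n), h1, integral_sub (hQ _) (hQ _)]
    rfl
  rw [e] at hn
  linarith

end Functionals

/-! ### The potential well. -/

variable {μ : ℝ}

lemma formA_nonneg (hN : 3 ≤ N) (hμ : μ ≤ ((N : ℝ) - 2) ^ 2 / 8) (v : X N) :
    0 ≤ formA hN μ v v :=
  le_trans (by positivity) (formA_coercive hN hμ v)

lemma norm_sq_le_formA (hN : 3 ≤ N) (hμ : μ ≤ ((N : ℝ) - 2) ^ 2 / 8) (v : X N) :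
    ‖v‖ ^ 2 ≤ 2 * N * formA hN μ v v := by
  have hN' : (3 : ℝ) ≤ N := by exact_mod_cast hN
  have h1 := formA_coercive hN hμ v
  have h2 := X.poincare v
  have h3 := X.norm_sq v
  rw [div_le_iff₀ (by linarith)] at h1
  nlinarith [sq_nonneg ‖v.fn‖]

lemma formA_pos (hN : 3 ≤ N) (hμ : μ ≤ ((N : ℝ) - 2) ^ 2 / 8) {v : X N} (hv : v ≠ 0) :
    0 < formA hN μ v v := by
  have hN' : (3 : ℝ) ≤ N := by exact_mod_cast hN
  have h1 := norm_sq_le_formA hN hμ v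
  have h2 : 0 < ‖v‖ ^ 2 := by positivity
  by_contra h
  nlinarith

/-- Outside the open set where `D` is positive, `A` is at least `N d`. -/
lemma depth_le_formA (hN : 3 ≤ N) (hμ : μ ≤ ((N : ℝ) - 2) ^ 2 / 8) {v : X N} (hv : v ≠ 0)
    (hD : funD N μ v ≤ 0) : N * depth N μ ≤ formA hN μ v v := by
  have hN' : (3 : ℝ) ≤ N := by exact_mod_cast hN
  have hq := two_lt_critExp hN
  have hA := formA_pos hN hμ hv
  have hB := funB_pos hN hv
  have hAB : formA hN μ v v ≤ funB N v := by
    rw [funD, funA_eq hN] at hD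
    linarith
  set a := formA hN μ v v with ha
  set b := funB N v with hb
  -- This `t` solves `t² A = t^{2^*} B`, so `t v` lies on the Nehari manifold; `A ≤ B` gives `t ≤
  -- 1`, whence `N d ≤ N E(t v) = t² A ≤ A`.
  set t : ℝ := (a / b) ^ (critExp N - 2)⁻¹ with ht
  have ht0 : 0 < t := by positivity
  have ht1 : t ≤ 1 := Real.rpow_le_one (by positivity) (by rwa [div_le_one hB])
    (by simp; linarith)
  have htq : t ^ critExp N * b = t ^ 2 * a := by
    have h1 : t ^ (critExp N - 2) = a / b := by
      rw [ht, ← Real.rpow_mul (by positivity), inv_mul_cancel₀ (by linarith), Real.rpow_one]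
    have h2 : t ^ critExp N = t ^ (critExp N - 2) * t ^ 2 := by
      rw [← Real.rpow_natCast, ← Real.rpow_add ht0]
      congr 1
      push_cast
      ring
    rw [h2, h1]
    field_simp
  have hDt : funD N μ (t • v) = 0 := by
    rw [funD, funA_eq hN, formA_smul_self, funB_smul ht0.le, htq, sub_self]
  have hmem : t • v ∈ nehari N μ := ⟨hDt, smul_ne_zero ht0.ne' hv⟩
  have hbdd : BddBelow (energy N μ '' nehari N μ) := by
    refine ⟨0, ?_⟩
    rintro _ ⟨w, ⟨hw, -⟩, rfl⟩
    rw [energy_eq hN, hw]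
    have := formA_nonneg hN hμ w
    positivity
  have hle : depth N μ ≤ energy N μ (t • v) := csInf_le hbdd ⟨_, hmem, rfl⟩
  rw [energy_eq hN, hDt, formA_smul_self, ← ha, zero_div, add_zero, le_div_iff₀ (by linarith)] at hle
  have : t ^ 2 ≤ 1 := pow_le_one₀ ht0.le ht1
  nlinarith

/-- Used for competitors and for remainders `u_n - v`, which may vanish; hence the non-strict
conclusion and no energy hypothesis. -/
lemma funD_nonneg_of_lt (hN : 3 ≤ N) (hμ : μ ≤ ((N : ℝ) - 2) ^ 2 / 8) {v : X N}
    (h : formA hN μ v v < N * depth N μ) : 0 ≤ funD N μ v := by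
  have hq := two_lt_critExp hN
  rcases eq_or_ne v 0 with rfl | hv
  · have e : (0 : X N) = (0 : ℝ) • (0 : X N) := by simp
    rw [funD, funA_eq hN, e, formA_smul_self, funB_smul le_rfl,
      Real.zero_rpow (by linarith : critExp N ≠ 0)]
    simp
  · by_contra hD
    exact absurd (depth_le_formA hN hμ hv (not_le.1 hD).le) (not_le.2 h)

lemma mem_well_of_lt (hN : 3 ≤ N) (hμ : μ ≤ ((N : ℝ) - 2) ^ 2 / 8) {v : X N}
    (h : formA hN μ v v < N * depth N μ) (hE : energy N μ v < depth N μ) : v ∈ well N μ := by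
  by_cases hv : v = 0
  · exact Or.inr hv
  · refine Or.inl ⟨?_, hE⟩
    by_contra hD
    exact absurd (depth_le_formA hN hμ hv (not_lt.1 hD)) (not_le.2 h)

lemma formA_le_energy (hN : 3 ≤ N) {v : X N} (hD : 0 ≤ funD N μ v) :
    formA hN μ v v ≤ N * energy N μ v := by
  have hN' : (3 : ℝ) ≤ N := by exact_mod_cast hN
  have hq := two_lt_critExp hN
  rw [energy_eq hN, mul_add, mul_div_cancel₀ _ (by linarith : (N : ℝ) ≠ 0)]
  have : 0 ≤ funD N μ v / critExp N := div_nonneg hD (by linarith)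
  nlinarith

/-- Weak lower semicontinuity of `A` and `E` below the depth of the well. -/
lemma weak_lsc (hN : 3 ≤ N) (hμ : μ ≤ ((N : ℝ) - 2) ^ 2 / 8) {u : ℕ → X N} {v : X N} {R : ℝ}
    (hR : R < N * depth N μ) (hu : ∀ n, formA hN μ (u n) (u n) ≤ R) (h : WeakTendsto u v) :
    formA hN μ v v ≤ R ∧ ∀ ε > 0, ∀ᶠ n in atTop, energy N μ v ≤ energy N μ (u n) + ε := by
  have hN' : (3 : ℝ) ≤ N := by exact_mod_cast hN
  have hq := two_lt_critExp hN
  have hb (n : ℕ) : ‖u n‖ ≤ Real.sqrt (2 * N * R) := by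
    refine Real.le_sqrt_of_sq_le ((norm_sq_le_formA hN hμ (u n)).trans ?_)
    have := hu n
    gcongr
  have hsplit (n : ℕ) : formA hN μ (u n) (u n) =
      formA hN μ v v + 2 * formA hN μ v (u n - v) + formA hN μ (u n - v) (u n - v) := by
    rw [← formA_add_self, add_sub_cancel]
  have hz : Tendsto (fun n => formA hN μ v (u n - v)) atTop (𝓝 0) := by
    have h1 := (h.formA hN μ v).sub_const (formA hN μ v v)
    rw [sub_self] at h1
    refine h1.congr fun n => ?_
    rw [formA_comm hN μ v (u n - v), formA_sub_left]
  constructor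
  · have h1 : Tendsto (fun n => R - 2 * formA hN μ v (u n - v)) atTop (𝓝 (R - 2 * 0)) :=
      (hz.const_mul 2).const_sub R
    rw [mul_zero, sub_zero] at h1
    refine ge_of_tendsto' h1 fun n => ?_
    have := formA_nonneg hN hμ (u n - v)
    have := hsplit n
    have := hu n
    linarith
  · intro ε hε
    -- The bound `ε/2` absorbs the cross term in the energy; the bound `(N d - R)/4`, doubled by the
    -- cross term of `A`, keeps `A(u_n - v) ≤ R + (N d - R)/2 < N d`.
    have hη : 0 < min (ε / 2) ((N * depth N μ - R) / 4) := lt_min (by linarith) (by linarith)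
    filter_upwards [eventually_funB_le hN hb h (ε := ε) hε,
      hz.eventually (Ioo_mem_nhds (neg_lt_zero.2 hη) hη)] with n h1 h2
    have h3 := hsplit n
    have h4 := hu n
    have h5 := formA_nonneg hN hμ v
    obtain ⟨h6, -⟩ := h2
    have h7 : -(ε / 2) < formA hN μ v (u n - v) :=
      lt_of_le_of_lt (neg_le_neg (min_le_left _ _)) h6
    have h8 : -((N * depth N μ - R) / 4) < formA hN μ v (u n - v) :=
      lt_of_le_of_lt (neg_le_neg (min_le_right _ _)) h6
    have h9 : formA hN μ (u n - v) (u n - v) < N * depth N μ := by linarith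
    have h10 := funD_nonneg_of_lt hN hμ h9
    -- The possible loss of compactness costs no energy: the remainder satisfies `A < N d`, so its
    -- energy is nonnegative.
    have h11 : 0 ≤ energy N μ (u n - v) := by
      rw [energy_eq hN]
      exact add_nonneg (div_nonneg (formA_nonneg hN hμ _) (by linarith))
        (div_nonneg h10 (by linarith))
    simp only [energy, funA_eq hN] at h11 ⊢
    have h12 : 1 / critExp N * funB N (u n) ≤
        1 / critExp N * (funB N v + funB N (u n - v) + ε) :=
      mul_le_mul_of_nonneg_left h1 (by positivity)
    have h13 : 1 / critExp N * ε ≤ 1 / 2 * ε :=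
      mul_le_mul_of_nonneg_right (one_div_le_one_div_of_le (by norm_num) hq.le) hε.le
    linarith

/-! ### One implicit Euler step as a constrained minimization. -/

/-- Existence of a minimizer in one step of the implicit time discretization. -/
lemma exists_minimizer (hN : 3 ≤ N) (hμ : μ ≤ ((N : ℝ) - 2) ^ 2 / 8) {R : ℝ}
    (hR : R < N * depth N μ) (c : ℝ) (hc : 0 ≤ c) (u : X N) (hu : formA hN μ u u ≤ R) :
    ∃ v : X N, formA hN μ v v ≤ R ∧ ∀ w : X N, formA hN μ w w ≤ R →
      energy N μ v + c * ‖v.fn - u.fn‖ ^ 2 ≤ energy N μ w + c * ‖w.fn - u.fn‖ ^ 2 := by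
  have hN' : (3 : ℝ) ≤ N := by exact_mod_cast hN
  have hq := two_lt_critExp hN
  let Φ : X N → ℝ := fun w => energy N μ w + c * ‖w.fn - u.fn‖ ^ 2
  let S : Set (X N) := {w | formA hN μ w w ≤ R}
  have hbdd : BddBelow (Φ '' S) := by
    refine ⟨0, ?_⟩
    rintro _ ⟨w, hw, rfl⟩
    have h1 := funD_nonneg_of_lt hN hμ (lt_of_le_of_lt hw hR)
    have h2 := formA_nonneg hN hμ w
    simp only [Φ]
    rw [energy_eq hN]
    positivity
  have hne : (Φ '' S).Nonempty := ⟨_, u, hu, rfl⟩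
  set m := sInf (Φ '' S) with hm
  have hseq (n : ℕ) : ∃ w ∈ S, Φ w < m + 1 / ((n : ℝ) + 1) := by
    obtain ⟨_, ⟨w, hw, rfl⟩, hlt⟩ := exists_lt_of_csInf_lt hne
      (lt_add_of_pos_right m (by positivity : 0 < 1 / ((n : ℝ) + 1)))
    exact ⟨w, hw, hlt⟩
  choose x hxS hxm using hseq
  have hb (n : ℕ) : ‖x n‖ ≤ Real.sqrt (2 * N * R) := by
    refine Real.le_sqrt_of_sq_le ((norm_sq_le_formA hN hμ (x n)).trans ?_)
    have := hxS n
    gcongr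
    exact this
  obtain ⟨v, ns, hns, hv⟩ := exists_weakTendsto_subseq hb
  obtain ⟨hAv, hEv⟩ := weak_lsc hN hμ hR (fun n => hxS (ns n)) hv
  refine ⟨v, hAv, fun w hw => ?_⟩
  suffices Φ v ≤ m from this.trans (csInf_le hbdd ⟨w, hw, rfl⟩)
  -- The penalty term converges by the compact embedding, so only `E` requires lower semicontinuity.
  have hfn := tendsto_fn_of_weakTendsto (fun n => hb (ns n)) hv
  have h1 : Tendsto (fun n => c * ‖(x (ns n)).fn - u.fn‖ ^ 2) atTop
      (𝓝 (c * ‖v.fn - u.fn‖ ^ 2)) := ((hfn.sub_const _).norm.pow 2).const_mul c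
  refine le_of_forall_pos_le_add fun ε hε => ?_
  have h2 : Tendsto (fun n => 1 / ((ns n : ℝ) + 1)) atTop (𝓝 0) :=
    (tendsto_one_div_add_atTop_nhds_zero_nat (𝕜 := ℝ)).comp hns.tendsto_atTop
  obtain ⟨n, hn1, hn2, hn3⟩ := ((hEv (ε / 3) (by positivity)).and
    ((h1.eventually (lt_mem_nhds (sub_lt_self _ (by positivity : 0 < ε / 3)))).and
      (h2.eventually (gt_mem_nhds (by positivity : 0 < ε / 3))))).exists
  have := hxm (ns n)
  simp only [Φ] at this ⊢
  linarith

/-- `B` enters the energy with a minus sign, so this convexity bound from below alone yields the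
Euler–Lagrange equation; differentiability of `B` is not needed. -/
lemma funB_tangent (hN : 3 ≤ N) (v w : X N) :
    funB N v + critExp N * nlPairing N v w ≤ funB N (v + w) := by
  have hq := two_lt_critExp hN
  rw [funB, funB, nlPairing, ← integral_const_mul, ← integral_add (X.integrable_abs_rpow hN v)
    ((integrable_nlPairing hN v w).const_mul _)]
  refine integral_mono_ae ((X.integrable_abs_rpow hN v).add
    ((integrable_nlPairing hN v w).const_mul _)) (X.integrable_abs_rpow hN (v + w)) ?_
  rw [X.fn_add]
  filter_upwards [Lp.coeFn_add v.fn w.fn] with y hy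
  rw [hy, Pi.add_apply]
  exact abs_rpow_add_le (by linarith) _ _

lemma nlPairing_smul (t : ℝ) (v w : X N) : nlPairing N v (t • w) = t * nlPairing N v w := by
  rw [nlPairing, nlPairing, ← integral_const_mul, X.fn_smul]
  refine integral_congr_ae ?_
  filter_upwards [Lp.coeFn_smul t w.fn] with y hy
  rw [hy, Pi.smul_apply, smul_eq_mul]
  ring

lemma eq_zero_of_forall_small_quadratic {b c η : ℝ} (hη : 0 < η)
    (h : ∀ t : ℝ, |t| < η → 0 ≤ t * b + t ^ 2 * c) : b = 0 := by
  by_contra hb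
  set s := min (η / 2) (|b| / (2 * (|c| + 1))) with hs
  have hb' : 0 < |b| := abs_pos.2 hb
  have hs0 : 0 < s := lt_min (by positivity) (by positivity)
  have hs1 : s < η := lt_of_le_of_lt (min_le_left _ _) (by linarith)
  have hs2 : s * (|c| + 1) ≤ |b| / 2 := by
    have : s ≤ |b| / (2 * (|c| + 1)) := min_le_right _ _
    rw [le_div_iff₀ (by positivity)] at this
    linarith
  have hs3 : s * c ≤ s * (|c| + 1) := by
    have := le_abs_self c
    gcongr
    linarith
  rcases lt_or_gt_of_ne hb with hneg | hpos
  · have h1 := h s (by rwa [abs_of_pos hs0])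
    rw [abs_of_neg hneg] at *
    nlinarith
  · have h1 := h (-s) (by rwa [abs_neg, abs_of_pos hs0])
    rw [abs_of_pos hpos] at *
    nlinarith

/-- One step of the implicit time discretization. -/
lemma exists_step (hN : 3 ≤ N) (hμ : μ ≤ ((N : ℝ) - 2) ^ 2 / 8) {e τ : ℝ}
    (he : e < depth N μ) (hτ : 0 < τ) (u : X N) (hE : energy N μ u ≤ e)
    (hA : formA hN μ u u ≤ N * e) :
    ∃ v : X N, energy N μ v ≤ e ∧ formA hN μ v v ≤ N * e ∧
      energy N μ v + 1 / (2 * τ) * ‖v.fn - u.fn‖ ^ 2 ≤ energy N μ u ∧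
      ∀ w : X N, 1 / τ * inner ℝ (v.fn - u.fn) w.fn + formA hN μ v w = nlPairing N v w := by
  have hN' : (3 : ℝ) ≤ N := by exact_mod_cast hN
  have hq := two_lt_critExp hN
  -- Any level strictly between `N e` and `N d` would do: below `N d` for existence, above `N e` so
  -- that the minimizer is interior.
  set R := N * ((e + depth N μ) / 2) with hRdef
  have hR : R < N * depth N μ := by
    rw [hRdef]
    gcongr
    linarith
  have heR : N * e < R := by
    rw [hRdef]
    gcongr
    linarith
  obtain ⟨v, hvR, hmin⟩ := exists_minimizer hN hμ hR (1 / (2 * τ)) (by positivity) u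
    (hA.trans heR.le)
  have h1 : energy N μ v + 1 / (2 * τ) * ‖v.fn - u.fn‖ ^ 2 ≤ energy N μ u := by
    simpa using hmin u (hA.trans heR.le)
  have h2 : energy N μ v ≤ e := by
    have : 0 ≤ 1 / (2 * τ) * ‖v.fn - u.fn‖ ^ 2 := by positivity
    linarith
  -- The a priori bound `A ≤ N E` improves the constraint `A ≤ R` to `A ≤ N e < R`, so small
  -- variations in every direction are admissible.
  have h3 : formA hN μ v v ≤ N * e :=
    (formA_le_energy hN (funD_nonneg_of_lt hN hμ (hvR.trans_lt hR))).trans (by gcongr)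
  refine ⟨v, h2, h3, h1, fun w => ?_⟩
  have hcont : Tendsto (fun t : ℝ => formA hN μ (v + t • w) (v + t • w)) (𝓝 0)
      (𝓝 (formA hN μ v v)) := by
    have hc : Continuous fun t : ℝ => formA hN μ v v + 2 * (t * formA hN μ v w) +
        t ^ 2 * formA hN μ w w := by fun_prop
    have := hc.tendsto 0
    simp only [formA_add_smul_self]
    simpa using this
  obtain ⟨η, hη, hball⟩ := Metric.eventually_nhds_iff.1
    (hcont.eventually (gt_mem_nhds (h3.trans_lt heR)))
  have key : 1 / τ * inner ℝ (v.fn - u.fn) w.fn + formA hN μ v w - nlPairing N v w = 0 := by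
    -- Along `v + t w` the functional increases by at most `t b + t² c`, and by at least `0` for
    -- small `|t|`; the sign of `t` is free, so `b = 0`.
    refine eq_zero_of_forall_small_quadratic
      (c := 1 / 2 * formA hN μ w w + 1 / (2 * τ) * ‖w.fn‖ ^ 2) hη fun t ht => ?_
    have ht' : formA hN μ (v + t • w) (v + t • w) < R := hball (by simpa using ht)
    have hm := hmin (v + t • w) ht'.le
    have hB := funB_tangent hN v (t • w)
    rw [nlPairing_smul] at hB
    have hB' := mul_le_mul_of_nonneg_left hB (by positivity : 0 ≤ 1 / critExp N)
    have hnorm : ‖(v + t • w).fn - u.fn‖ ^ 2 = ‖v.fn - u.fn‖ ^ 2 +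
        2 * (t * inner ℝ (v.fn - u.fn) w.fn) + t ^ 2 * ‖w.fn‖ ^ 2 := by
      rw [X.fn_add, X.fn_smul, add_sub_right_comm, norm_add_sq_real, inner_smul_right, norm_smul,
        mul_pow, Real.norm_eq_abs, sq_abs]
    simp only [energy, funA_eq hN, formA_add_smul_self] at hm
    rw [hnorm] at hm
    have e1 : 1 / critExp N * (funB N v + critExp N * (t * nlPairing N v w)) =
        1 / critExp N * funB N v + t * nlPairing N v w := by field_simp
    have e2 : 1 / (2 * τ) * (‖v.fn - u.fn‖ ^ 2 + 2 * (t * inner ℝ (v.fn - u.fn) w.fn) +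
        t ^ 2 * ‖w.fn‖ ^ 2) = 1 / (2 * τ) * ‖v.fn - u.fn‖ ^ 2 +
        t * (1 / τ * inner ℝ (v.fn - u.fn) w.fn) + t ^ 2 * (1 / (2 * τ) * ‖w.fn‖ ^ 2) := by
      field_simp
    rw [e1] at hB'
    rw [e2] at hm
    linarith
  linarith

/-! ### Step functions in time and their primitives. -/

section StepFunctions

lemma stronglyMeasurable_floor_comp {E : Type*} [TopologicalSpace E] (F : ℕ → E) (τ : ℝ) :
    StronglyMeasurable fun s : ℝ => F ⌊s / τ⌋₊ :=
  (StronglyMeasurable.of_discrete (f := F)).comp_measurable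
    (Nat.measurable_floor.comp (measurable_id.div_const τ))

lemma lintegral_floor_le (F : ℕ → ℝ≥0∞) {τ : ℝ} (hτ : 0 < τ) :
    ∫⁻ s in Ioi 0, F ⌊s / τ⌋₊ ≤ ∑' k, F k * ENNReal.ofReal τ := by
  have hm : Measurable fun s : ℝ => ⌊s / τ⌋₊ :=
    Nat.measurable_floor.comp (measurable_id.div_const τ)
  rw [← lintegral_map (f := F) (measurable_of_countable F) hm, lintegral_countable']
  refine ENNReal.tsum_le_tsum fun k => mul_le_mul_right ?_ _
  rw [Measure.map_apply hm (measurableSet_singleton k), Measure.restrict_apply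
    (hm (measurableSet_singleton k))]
  have hsub : ((fun s : ℝ => ⌊s / τ⌋₊) ⁻¹' {k}) ∩ Ioi 0 ⊆ Ico (k * τ) ((k + 1) * τ) := by
    rintro s ⟨hs, hs0⟩
    have hs0' : 0 < s := hs0
    have h1 : ⌊s / τ⌋₊ = k := hs
    rw [Nat.floor_eq_iff (by positivity), le_div_iff₀ hτ, div_lt_iff₀ hτ] at h1
    exact h1
  refine (measure_mono hsub).trans_eq ?_
  rw [Real.volume_Ico]
  congr 1
  ring

lemma intervalIntegrable_of_memLp {E : Type*} [NormedAddCommGroup E] {g : ℝ → E}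
    (hg : MemLp g 2 (volume.restrict (Ioi 0)))
    {s t : ℝ} (hs : 0 ≤ s) (ht : 0 ≤ t) : IntervalIntegrable g volume s t := by
  rw [intervalIntegrable_iff]
  have h1 : MemLp g 2 (volume.restrict (uIoc s t)) :=
    hg.mono_measure (Measure.restrict_mono (fun x hx => lt_of_le_of_lt (le_min hs ht) hx.1) le_rfl)
  have : IsFiniteMeasure (volume.restrict (uIoc s t)) := ⟨by simp [uIoc]⟩
  exact h1.integrable (by norm_num)

variable {G : Type*} [NormedAddCommGroup G] [InnerProductSpace ℝ G]

/-- The difference quotients of a sequence, as a step function in time. -/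
def stepDeriv (b : ℕ → G) (τ : ℝ) (s : ℝ) : G := (1 / τ) • (b (⌊s / τ⌋₊ + 1) - b ⌊s / τ⌋₊)

lemma stronglyMeasurable_stepDeriv (b : ℕ → G) (τ : ℝ) : StronglyMeasurable (stepDeriv b τ) :=
  stronglyMeasurable_floor_comp (fun k => (1 / τ) • (b (k + 1) - b k)) τ

lemma eLpNorm_stepDeriv_sq_le {b : ℕ → G} {τ C : ℝ} (hτ : 0 < τ)
    (hb : ∀ m, ∑ k ∈ Finset.range m, 1 / τ * ‖b (k + 1) - b k‖ ^ 2 ≤ C) :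
    eLpNorm (stepDeriv b τ) 2 (volume.restrict (Ioi 0)) ^ 2 ≤ ENNReal.ofReal C := by
  rw [eLpNorm_two_sq]
  refine (lintegral_floor_le (fun k => ‖(1 / τ) • (b (k + 1) - b k)‖ₑ ^ 2) hτ).trans ?_
  refine ENNReal.tsum_le_of_sum_range_le fun m => ?_
  refine le_trans (le_of_eq ?_) (ENNReal.ofReal_le_ofReal (hb m))
  rw [ENNReal.ofReal_sum_of_nonneg fun k _ => by positivity]
  refine Finset.sum_congr rfl fun k _ => ?_
  rw [← ofReal_norm, ← ENNReal.ofReal_pow (norm_nonneg _), ← ENNReal.ofReal_mul (by positivity),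
    norm_smul, Real.norm_of_nonneg (by positivity)]
  congr 1
  field_simp

lemma memLp_stepDeriv {b : ℕ → G} {τ C : ℝ} (hτ : 0 < τ)
    (hb : ∀ m, ∑ k ∈ Finset.range m, 1 / τ * ‖b (k + 1) - b k‖ ^ 2 ≤ C) :
    MemLp (stepDeriv b τ) 2 (volume.restrict (Ioi 0)) := by
  refine ⟨(stronglyMeasurable_stepDeriv b τ).aestronglyMeasurable, ?_⟩
  have h := (eLpNorm_stepDeriv_sq_le hτ hb).trans_lt ENNReal.ofReal_lt_top
  by_contra hcon
  rw [not_lt_top_iff.1 hcon] at h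
  simp at h

variable [CompleteSpace G]

lemma integral_stepDeriv_piece (b : ℕ → G) {τ : ℝ} (hτ : 0 < τ) (k : ℕ) {s : ℝ}
    (h1 : k * τ ≤ s) (h2 : s ≤ (k + 1) * τ) :
    ∫ x in (k * τ)..s, stepDeriv b τ x = ((s - k * τ) / τ) • (b (k + 1) - b k) := by
  rw [intervalIntegral.integral_of_le h1, integral_Ioc_eq_integral_Ioo,
    setIntegral_congr_fun (g := fun _ => (1 / τ) • (b (k + 1) - b k)) measurableSet_Ioo]
  · rw [setIntegral_const, smul_smul]
    simp only [Real.volume_real_Ioo_of_le h1]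
    congr 1
    ring
  · rintro x ⟨hx1, hx2⟩
    have hk : ⌊x / τ⌋₊ = k := by
      have : 0 ≤ (k : ℝ) * τ := by positivity
      rw [Nat.floor_eq_iff (div_nonneg (by linarith) hτ.le), le_div_iff₀ hτ, div_lt_iff₀ hτ]
      exact ⟨hx1.le, by linarith⟩
    simp only [stepDeriv, hk]

/-- The primitive is the piecewise linear interpolant of the nodes. -/
lemma integral_stepDeriv {b : ℕ → G} {τ : ℝ} (hτ : 0 < τ)
    (hb : MemLp (stepDeriv b τ) 2 (volume.restrict (Ioi 0))) {s : ℝ} (hs : 0 ≤ s) :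
    ∫ x in (0 : ℝ)..s, stepDeriv b τ x = b ⌊s / τ⌋₊ - b 0 +
      ((s - ⌊s / τ⌋₊ * τ) / τ) • (b (⌊s / τ⌋₊ + 1) - b ⌊s / τ⌋₊) := by
  have hnode (k : ℕ) : ∫ x in (0 : ℝ)..(k * τ), stepDeriv b τ x = b k - b 0 := by
    induction k with
    | zero => simp
    | succ k ih =>
      rw [← intervalIntegral.integral_add_adjacent_intervals (b := k * τ)
        (intervalIntegrable_of_memLp hb le_rfl (by positivity))
        (intervalIntegrable_of_memLp hb (by positivity) (by positivity)), ih,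
        integral_stepDeriv_piece b hτ k (by push_cast; nlinarith) (by push_cast; rfl)]
      have : (((k + 1 : ℕ) : ℝ) * τ - k * τ) / τ = 1 := by
        push_cast
        field_simp
        ring
      rw [this, one_smul]
      abel
  have h1 : ⌊s / τ⌋₊ * τ ≤ s := (le_div_iff₀ hτ).1 (Nat.floor_le (by positivity))
  have h2 : s ≤ (⌊s / τ⌋₊ + 1) * τ := ((div_lt_iff₀ hτ).1 (Nat.lt_floor_add_one _)).le
  rw [← intervalIntegral.integral_add_adjacent_intervals (b := ⌊s / τ⌋₊ * τ)
    (intervalIntegrable_of_memLp hb le_rfl (by positivity))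
    (intervalIntegrable_of_memLp hb (by positivity) hs), hnode, integral_stepDeriv_piece b hτ _ h1 h2]

/-- Compares the right-endpoint step function with the interpolant, so that both have the same limit
as `τ → 0`. -/
lemma norm_sub_integral_stepDeriv_le {b : ℕ → G} {τ : ℝ} (hτ : 0 < τ)
    (hb : MemLp (stepDeriv b τ) 2 (volume.restrict (Ioi 0))) {s : ℝ} (hs : 0 ≤ s) :
    ‖b (⌊s / τ⌋₊ + 1) - (b 0 + ∫ x in (0 : ℝ)..s, stepDeriv b τ x)‖ ≤
      ‖b (⌊s / τ⌋₊ + 1) - b ⌊s / τ⌋₊‖ := by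
  have h1 : ⌊s / τ⌋₊ * τ ≤ s := (le_div_iff₀ hτ).1 (Nat.floor_le (by positivity))
  have h2 : s ≤ (⌊s / τ⌋₊ + 1) * τ := ((div_lt_iff₀ hτ).1 (Nat.lt_floor_add_one _)).le
  rw [integral_stepDeriv hτ hb hs]
  set θ := (s - ⌊s / τ⌋₊ * τ) / τ with hθ
  have hθ0 : 0 ≤ θ := div_nonneg (by linarith) hτ.le
  have hθ1 : θ ≤ 1 := by
    rw [hθ, div_le_one hτ]
    linarith
  have e : b (⌊s / τ⌋₊ + 1) - (b 0 + (b ⌊s / τ⌋₊ - b 0 + θ • (b (⌊s / τ⌋₊ + 1) - b ⌊s / τ⌋₊))) =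
      (1 - θ) • (b (⌊s / τ⌋₊ + 1) - b ⌊s / τ⌋₊) := by
    module
  rw [e, norm_smul, Real.norm_of_nonneg (by linarith)]
  exact mul_le_of_le_one_left (norm_nonneg _) (by linarith)

/-- Weak convergence in `L²(0, ∞; G)` implies weak convergence of the primitives. -/
lemma WeakTendsto.integral {g : ℕ → Lp G 2 (volume.restrict (Ioi (0 : ℝ)))}
    {g₀ : Lp G 2 (volume.restrict (Ioi (0 : ℝ)))} (h : WeakTendsto g g₀) {s : ℝ} (hs : 0 ≤ s) :
    WeakTendsto (fun n => ∫ x in (0 : ℝ)..s, g n x) (∫ x in (0 : ℝ)..s, g₀ x) := by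
  intro w
  have hfin : volume.restrict (Ioi (0 : ℝ)) (Ioc 0 s) ≠ ⊤ :=
    ((Measure.restrict_apply_le _ _).trans_lt (by simp)).ne
  have e (f : Lp G 2 (volume.restrict (Ioi (0 : ℝ)))) :
      -- Pairing the primitive with `w` is pairing `f` with `1_{(0,s]} w`, an element of `L²(0,∞;
      -- G)`.
      inner ℝ (∫ x in (0 : ℝ)..s, f x) w =
        inner ℝ f (indicatorConstLp 2 measurableSet_Ioc hfin w) := by
    rw [real_inner_comm, real_inner_comm (indicatorConstLp 2 measurableSet_Ioc hfin w),
      L2.inner_indicatorConstLp_eq_inner_setIntegral,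
      Measure.restrict_restrict_of_subset Ioc_subset_Ioi_self, intervalIntegral.integral_of_le hs]
  simp only [e]
  exact h _

end StepFunctions

/-! ### Discrete solutions, the limit `τ → 0`, and the theorem. -/

lemma energy_nonneg_of_lt (hN : 3 ≤ N) (hμ : μ ≤ ((N : ℝ) - 2) ^ 2 / 8) {v : X N}
    (h : formA hN μ v v < N * depth N μ) : 0 ≤ energy N μ v := by
  have hq := two_lt_critExp hN
  rw [energy_eq hN]
  exact add_nonneg (div_nonneg (formA_nonneg hN hμ _) (by positivity))
    (div_nonneg (funD_nonneg_of_lt hN hμ h) (by linarith))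

/-- The implicit time discretization with step `τ`. -/
lemma exists_discrete_solution (hN : 3 ≤ N) (hμ : μ ≤ ((N : ℝ) - 2) ^ 2 / 8) {e τ : ℝ}
    (he : e < depth N μ) (hτ : 0 < τ) (u : X N) (hE : energy N μ u ≤ e)
    (hA : formA hN μ u u ≤ N * e) :
    ∃ a : ℕ → X N, a 0 = u ∧ (∀ k, energy N μ (a k) ≤ e) ∧ (∀ k, formA hN μ (a k) (a k) ≤ N * e) ∧
      (∀ m, ∑ k ∈ Finset.range m, 1 / τ * ‖(a (k + 1)).fn - (a k).fn‖ ^ 2 ≤ 2 * e) ∧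
      ∀ k, ∀ w : X N, 1 / τ * inner ℝ ((a (k + 1)).fn - (a k).fn) w.fn +
        formA hN μ (a (k + 1)) w = nlPairing N (a (k + 1)) w := by
  have hN' : (3 : ℝ) ≤ N := by exact_mod_cast hN
  choose! f hf1 hf2 hf3 hf4 using fun u => exists_step hN hμ he hτ u
  let a : ℕ → X N := fun k => f^[k] u
  have ha (k : ℕ) : a (k + 1) = f (a k) := Function.iterate_succ_apply' f k u
  have hinv (k : ℕ) : energy N μ (a k) ≤ e ∧ formA hN μ (a k) (a k) ≤ N * e := by
    induction k with
    | zero => exact ⟨hE, hA⟩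
    | succ k ih =>
      rw [ha]
      exact ⟨hf1 _ ih.1 ih.2, hf2 _ ih.1 ih.2⟩
  refine ⟨a, rfl, fun k => (hinv k).1, fun k => (hinv k).2, fun m => ?_, fun k w => ?_⟩
  -- The energy inequality telescopes; nonnegativity of the final energy makes the bound `2 e`
  -- independent of `m` and `τ`.
  · have h1 : ∀ m, ∑ k ∈ Finset.range m, 1 / τ * ‖(a (k + 1)).fn - (a k).fn‖ ^ 2 ≤
        2 * (e - energy N μ (a m)) := by
      intro m
      induction m with
      | zero => simpa using (hinv 0).1
      | succ m ih =>
        rw [Finset.sum_range_succ]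
        have h2 := hf3 _ (hinv m).1 (hinv m).2
        rw [← ha] at h2
        have h3 : 1 / τ * ‖(a (m + 1)).fn - (a m).fn‖ ^ 2 =
            2 * (1 / (2 * τ) * ‖(a (m + 1)).fn - (a m).fn‖ ^ 2) := by
          field_simp
        linarith
    have h4 : 0 ≤ energy N μ (a m) :=
      energy_nonneg_of_lt hN hμ ((hinv m).2.trans_lt (by gcongr))
    linarith [h1 m]
  · rw [ha]
    exact hf4 _ (hinv k).1 (hinv k).2 w

lemma timeInterval_top : timeInterval ⊤ = Ioi 0 := by
  ext s
  simp [timeInterval, EReal.coe_lt_top]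

lemma exists_abs_formA_le (hN : 3 ≤ N) (μ : ℝ) (w : X N) :
    ∃ C : ℝ, 0 ≤ C ∧ ∀ v : X N, |formA hN μ v w| ≤ C * ‖v‖ := by
  let ℓ : X N →L[ℝ] ℝ := (innerSL ℝ (gradL N w)).comp (gradL N) -
    μ • (innerSL ℝ (hardyL hN w)).comp (hardyL hN) - beta N • (innerSL ℝ (fnL N w)).comp (fnL N)
  have hℓ (v : X N) : ℓ v = formA hN μ v w := by
    rw [formA_comm]
    rfl
  refine ⟨‖ℓ‖, ℓ.opNorm_nonneg, fun v => ?_⟩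
  rw [← hℓ]
  exact ℓ.le_opNorm v

lemma abs_nlPairing_le (hN : 3 ≤ N) (v w : X N) : |nlPairing N v w| ≤ funB N v + funB N w := by
  have hq := two_lt_critExp hN
  rw [funB, funB, ← integral_add (X.integrable_abs_rpow hN v) (X.integrable_abs_rpow hN w),
    ← Real.norm_eq_abs]
  refine norm_integral_le_of_norm_le
    ((X.integrable_abs_rpow hN v).add (X.integrable_abs_rpow hN w)) (Eventually.of_forall fun y => ?_)
  rw [Real.norm_eq_abs, abs_mul, abs_rpow_sub_two_mul_self (by linarith)]
  simpa using rpow_sub_one_mul_le (by linarith : 1 < critExp N) one_pos (abs_nonneg (v.fn y))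
    (abs_nonneg (w.fn y))

instance : SecondCountableTopology (Lp (L2K N) 2 (volume.restrict (Ioi (0 : ℝ)))) :=
  have : Fact ((2 : ℝ≥0∞) ≠ ⊤) := ⟨by simp⟩
  inferInstance

/-- The discrete solutions converge: there are step functions `x n` in time with values in `X`, with
uniform bounds, that converge weakly at every time, together with their difference quotients, and
satisfy the equation up to the time discretization. -/
lemma exists_limit (hN : 3 ≤ N) (hμ : μ ≤ ((N : ℝ) - 2) ^ 2 / 8) {e : ℝ}
    (he : e < depth N μ) (u : X N) (hE : energy N μ u ≤ e) (hA : formA hN μ u u ≤ N * e) :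
    ∃ (x : ℕ → ℝ → X N) (v : ℝ → X N) (gn : ℕ → Lp (L2K N) 2 (volume.restrict (Ioi (0 : ℝ))))
      (g : Lp (L2K N) 2 (volume.restrict (Ioi (0 : ℝ)))),
      (∀ n s, energy N μ (x n s) ≤ e) ∧
      (∀ n s, formA hN μ (x n s) (x n s) ≤ N * e) ∧ WeakTendsto gn g ∧
      (∀ s, 0 ≤ s → WeakTendsto (fun n => x n s) (v s)) ∧
      (∀ s, 0 ≤ s → (v s).fn = u.fn + ∫ t in (0 : ℝ)..s, g t) ∧ (∀ s < 0, v s = u) ∧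
      ∀ n w, ∀ᵐ s ∂volume.restrict (Ioi (0 : ℝ)),
        inner ℝ (gn n s) w.fn = nlPairing N (x n s) w - formA hN μ (x n s) w := by
  let τ : ℕ → ℝ := fun n => 1 / ((n : ℝ) + 1)
  have hτ (n : ℕ) : 0 < τ n := by positivity
  choose a ha0 haE haA haS haW using fun n => exists_discrete_solution hN hμ he (hτ n) u hE hA
  let b : ℕ → ℕ → L2K N := fun n k => (a n k).fn
  have hmem (n : ℕ) : MemLp (stepDeriv (b n) (τ n)) 2 (volume.restrict (Ioi 0)) :=
    memLp_stepDeriv (hτ n) (haS n)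
  let gs : ℕ → Lp (L2K N) 2 (volume.restrict (Ioi (0 : ℝ))) := fun n => (hmem n).toLp
  have hgs (n : ℕ) : ‖gs n‖ ≤ Real.sqrt (2 * e) := by
    have h1 := eLpNorm_stepDeriv_sq_le (hτ n) (haS n)
    have he0 : 0 ≤ 2 * e := by simpa using haS n 0
    refine Real.le_sqrt_of_sq_le ?_
    simp only [gs, Lp.norm_toLp]
    rw [← ENNReal.toReal_pow]
    exact ENNReal.toReal_le_of_le_ofReal he0 h1
  obtain ⟨g, ns, hns, hg⟩ := exists_weakTendsto_subseq hgs
  -- The index `⌊s/τ⌋ + 1` is the right endpoint: the implicit scheme satisfies the equation at the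
  -- new node.
  let x : ℕ → ℝ → X N := fun n s => a (ns n) (⌊s / τ (ns n)⌋₊ + 1)
  have hxb (n : ℕ) (s : ℝ) : ‖x n s‖ ≤ Real.sqrt (2 * N * (N * e)) := by
    refine Real.le_sqrt_of_sq_le ((norm_sq_le_formA hN hμ _).trans ?_)
    have := haA (ns n) (⌊s / τ (ns n)⌋₊ + 1)
    gcongr
  have hτlim : Tendsto (fun n => Real.sqrt (τ (ns n) * (2 * e))) atTop (𝓝 0) := by
    have h1 : Tendsto (fun n => τ (ns n)) atTop (𝓝 0) :=
      (tendsto_one_div_add_atTop_nhds_zero_nat (𝕜 := ℝ)).comp hns.tendsto_atTop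
    have h2 := (Real.continuous_sqrt.tendsto _).comp (h1.mul_const (2 * e))
    simpa [Function.comp_def] using h2
  have hfn (s : ℝ) (hs : 0 ≤ s) :
      WeakTendsto (fun n => fnL N (x n s)) (u.fn + ∫ t in (0 : ℝ)..s, g t) := by
    intro w
    have h_int (n : ℕ) : ∫ t in (0 : ℝ)..s, gs n t = ∫ t in (0 : ℝ)..s, stepDeriv (b n) (τ n) t := by
      rw [intervalIntegral.integral_of_le hs, intervalIntegral.integral_of_le hs]
      refine integral_congr_ae ?_
      exact (Measure.restrict_mono (fun t ht => ht.1 : Ioc 0 s ⊆ Ioi 0) le_rfl).absolutelyContinuous.ae_le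
        (hmem n).coeFn_toLp
    have h1 := (hg.integral hs) w
    have h2 : Tendsto (fun n => inner ℝ (fnL N (x n s) -
        (u.fn + ∫ t in (0 : ℝ)..s, gs (ns n) t)) w) atTop (𝓝 0) := by
      refine squeeze_zero_norm (a := fun n => Real.sqrt (τ (ns n) * (2 * e)) * ‖w‖) (fun n => ?_)
        (by simpa using hτlim.mul_const ‖w‖)
      refine (norm_inner_le_norm _ _).trans ?_
      refine mul_le_mul_of_nonneg_right ?_ (norm_nonneg _)
      rw [h_int]
      have h3 := norm_sub_integral_stepDeriv_le (hτ (ns n)) (hmem (ns n)) hs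
      have e0 : b (ns n) 0 = u.fn := by simp only [b, ha0]
      rw [e0] at h3
      refine h3.trans (Real.le_sqrt_of_sq_le ?_)
      have h4 := haS (ns n) (⌊s / τ (ns n)⌋₊ + 1)
      -- A single increment is at most `√(2 e τ)`, by keeping one term of the dissipation sum.
      have h5 := (Finset.single_le_sum (f := fun k => 1 / τ (ns n) *
        ‖(a (ns n) (k + 1)).fn - (a (ns n) k).fn‖ ^ 2) (fun k _ => by
          have := hτ (ns n)
          positivity) (Finset.self_mem_range_succ _)).trans h4
      have h6 := hτ (ns n)
      rw [one_div, inv_mul_le_iff₀ h6] at h5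
      exact h5
    have h7 := h2.add ((tendsto_const_nhds (x := inner ℝ u.fn w)).add h1)
    rw [zero_add, ← inner_add_left] at h7
    refine h7.congr fun n => ?_
    rw [← inner_add_left, ← inner_add_left, sub_add_cancel]
  -- The limit in `L²_K` is already identified for each `s`, so boundedness in `X` gives weak
  -- convergence there along the same subsequence.
  choose! v hv1 hv2 using fun s hs =>
    exists_weakTendsto_of_injective (fun n => hxb n s) fnL_injective (hfn s hs)
  -- The constant extension to `s < 0` makes `s ↦ (v s).fn` continuous on all of `ℝ`, which serves
  -- measurability later.
  refine ⟨x, fun s => if 0 ≤ s then v s else u, fun n => gs (ns n), g,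
    fun n s => haE _ _, fun n s => haA _ _, hg, fun s hs => ?_, fun s hs => ?_, fun s hs => ?_,
    fun n w => ?_⟩
  · simp only [if_pos hs]
    exact hv2 s hs
  · simp only [if_pos hs]
    exact hv1 s hs
  · simp only [if_neg (not_le.2 hs)]
  · filter_upwards [(hmem (ns n)).coeFn_toLp] with s hs
    have h1 := haW (ns n) ⌊s / τ (ns n)⌋₊ w
    have h2 : gs (ns n) s = stepDeriv (b (ns n)) (τ (ns n)) s := hs
    rw [h2, stepDeriv, inner_smul_left]
    simp only [conj_trivial]
    exact eq_sub_of_add_eq h1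

/-- Global existence below the depth of the potential well. -/
lemma exists_global_solution (hN : 3 ≤ N) (hμ : μ ≤ ((N : ℝ) - 2) ^ 2 / 8) (v₀ : X N)
    (hE : energy N μ v₀ < depth N μ) (hD : 0 < funD N μ v₀) :
    ∃ v : ℝ → X N, IsWeakSolution N μ ⊤ v₀ v ∧ ∀ s : ℝ, 0 ≤ s → v s ∈ well N μ := by
  have hN' : (3 : ℝ) ≤ N := by exact_mod_cast hN
  obtain ⟨x, v, gn, g, hxE, hxA, hgn, hxv, hvint, hvneg, heq⟩ :=
    exists_limit hN hμ hE v₀ le_rfl (formA_le_energy hN hD.le)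
  set e := energy N μ v₀ with he
  have hNe : N * e < N * depth N μ := by gcongr
  have hlsc (s : ℝ) (hs : 0 ≤ s) := weak_lsc hN hμ hNe (fun n => hxA n s) (hxv s hs)
  set M := Real.sqrt (2 * N * (N * e)) with hM
  have hbound (z : X N) (hz : formA hN μ z z ≤ N * e) : ‖z‖ ≤ M := by
    refine Real.le_sqrt_of_sq_le ((norm_sq_le_formA hN hμ z).trans ?_)
    gcongr
  have hvb (s : ℝ) (hs : 0 ≤ s) : ‖v s‖ ≤ M := hbound _ (hlsc s hs).1
  have hwell (s : ℝ) (hs : 0 ≤ s) : v s ∈ well N μ := by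
    refine mem_well_of_lt hN hμ ((hlsc s hs).1.trans_lt hNe) (lt_of_le_of_lt ?_ hE)
    refine le_of_forall_pos_le_add fun ε hε => ?_
    obtain ⟨n, hn⟩ := ((hlsc s hs).2 ε hε).exists
    exact hn.trans (add_le_add_left (hxE n s) _)
  have hv0 : v 0 = v₀ := fnL_injective (by simpa [fnL_apply] using hvint 0 le_rfl)
  let G : ℝ → L2K N := (Ioi (0 : ℝ)).indicator g
  have hGmem : MemLp G 2 volume := (memLp_indicator_iff_restrict measurableSet_Ioi).2 (Lp.memLp g)
  have hGg : G =ᵐ[volume.restrict (Ioi 0)] g := indicator_ae_eq_restrict measurableSet_Ioi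
  have hGint (s : ℝ) (hs : 0 ≤ s) : ∫ t in (0 : ℝ)..s, G t = ∫ t in (0 : ℝ)..s, g t := by
    rw [intervalIntegral.integral_of_le hs, intervalIntegral.integral_of_le hs]
    exact integral_congr_ae
      ((Measure.restrict_mono Ioc_subset_Ioi_self le_rfl).absolutelyContinuous.ae_le hGg)
  have hGloc (s t : ℝ) : IntervalIntegrable G volume s t :=
    ((hGmem.locallyIntegrable (by norm_num)).integrableOn_isCompact
      isCompact_uIcc).intervalIntegrable
  have hvm : StronglyMeasurable v := by
    borelize (X N)
    borelize (L2K N)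
    -- A continuous injection between Polish spaces is a measurable embedding (Lusin–Souslin), so
    -- `v` is measurable into `X` because its image in `L²_K` is continuous in time.
    have hemb : MeasurableEmbedding (fnL N) := (fnL N).continuous.measurableEmbedding fnL_injective
    have hF : Continuous fun s : ℝ => v₀.fn + ∫ t in (0 : ℝ)..s, G t :=
      continuous_const.add (intervalIntegral.continuous_primitive hGloc 0)
    have hcomp : (fnL N) ∘ v = fun s : ℝ => v₀.fn + ∫ t in (0 : ℝ)..s, G t := by
      funext s
      rcases le_or_gt 0 s with hs | hs
      · rw [hGint s hs, Function.comp_apply, fnL_apply, hvint s hs]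
      · have h0 : ∫ t in (0 : ℝ)..s, G t = 0 := by
          rw [intervalIntegral.integral_of_ge hs.le, neg_eq_zero]
          refine setIntegral_eq_zero_of_forall_eq_zero fun t ht => ?_
          exact indicator_of_notMem (by simpa using ht.2) _
        rw [h0, add_zero, Function.comp_apply, hvneg s hs, fnL_apply]
    exact (hemb.measurable_comp_iff.1 (hcomp ▸ hF.measurable)).stronglyMeasurable
  refine ⟨v, ⟨⟨hvm.aestronglyMeasurable, M, ?_⟩, hv0, G, ⟨?_, fun s hs _ => ?_⟩,
    fun w s hs _ => ?_⟩, hwell⟩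
  · rw [timeInterval_top]
    filter_upwards [ae_restrict_mem measurableSet_Ioi] with s hs
    exact (X.norm_grad_le _).trans (hvb s (le_of_lt hs))
  · rw [timeInterval_top]
    exact hGmem.restrict _
  · rw [hGint s hs, hv0, hvint s hs]
  obtain ⟨C₁, hC₁, hform⟩ := exists_abs_formA_le hN μ w
  obtain ⟨C₂, hC₂, hB⟩ := exists_funB_le hN
  let P : X N → ℝ := fun z => nlPairing N z w - formA hN μ z w
  have hPb (z : X N) (hz : ‖z‖ ≤ M) : ‖P z‖ ≤ (C₂ * M) ^ critExp N + funB N w + C₁ * M := by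
    have h1 := abs_nlPairing_le hN z w
    have h2 := hB z M hz
    have h3 := (hform z).trans (mul_le_mul_of_nonneg_left hz hC₁)
    have h4 : ‖P z‖ ≤ |nlPairing N z w| + |formA hN μ z w| := abs_sub _ _
    linarith
  have hPlim (t : ℝ) (ht : 0 ≤ t) : Tendsto (fun n => P (x n t)) atTop (𝓝 (P (v t))) :=
    (tendsto_nlPairing hN (fun n => hbound _ (hxA n t)) (hxv t ht) w).sub ((hxv t ht).formA hN μ w)
  have hsub : Ioc 0 s ⊆ Ioi (0 : ℝ) := Ioc_subset_Ioi_self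
  have hae (n : ℕ) : ∀ᵐ t ∂volume.restrict (Ioc 0 s), inner ℝ (gn n t) w.fn = P (x n t) :=
    (Measure.restrict_mono hsub le_rfl).absolutelyContinuous.ae_le (heq n w)
  have hgi (f : Lp (L2K N) 2 (volume.restrict (Ioi (0 : ℝ)))) :
      IntegrableOn f (Ioc 0 s) :=
    (intervalIntegrable_iff_integrableOn_Ioc_of_le hs.le).1
      (intervalIntegrable_of_memLp (Lp.memLp f) le_rfl hs.le)
  have hPm (n : ℕ) : AEStronglyMeasurable (fun t => P (x n t)) (volume.restrict (Ioc 0 s)) :=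
    ((hgi (gn n)).aestronglyMeasurable.inner aestronglyMeasurable_const).congr (hae n)
  have hlimae : ∀ᵐ t ∂volume.restrict (Ioc 0 s),
      Tendsto (fun n => P (x n t)) atTop (𝓝 (P (v t))) := by
    filter_upwards [ae_restrict_mem measurableSet_Ioc] with t ht using hPlim t ht.1.le
  have hPvm : AEStronglyMeasurable (fun t => P (v t)) (volume.restrict (Ioc 0 s)) :=
    aestronglyMeasurable_of_tendsto_ae atTop hPm hlimae
  -- The right-hand sides converge at each time and are bounded uniformly by the `X` bound; the
  -- left-hand sides converge only after integration, through the weak limit of `gn`.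
  have hconv : Tendsto (fun n => ∫ t in Ioc 0 s, P (x n t)) atTop (𝓝 (∫ t in Ioc 0 s, P (v t))) :=
    tendsto_integral_of_dominated_convergence (fun _ => (C₂ * M) ^ critExp N + funB N w + C₁ * M)
      hPm (integrable_const _) (fun n => Eventually.of_forall fun t => hPb _ (hbound _ (hxA n t)))
      hlimae
  have hinner (f : ℝ → L2K N) (hf : IntegrableOn f (Ioc 0 s)) :
      ∫ t in Ioc 0 s, inner ℝ (f t) w.fn = inner ℝ (∫ t in (0 : ℝ)..s, f t) w.fn := by
    rw [intervalIntegral.integral_of_le hs.le, real_inner_comm, ← integral_inner hf]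
    simp only [real_inner_comm]
  have hGi : IntegrableOn G (Ioc 0 s) :=
    (intervalIntegrable_iff_integrableOn_Ioc_of_le hs.le).1 (hGloc 0 s)
  have hmain : ∫ t in Ioc 0 s, inner ℝ (G t) w.fn = ∫ t in Ioc 0 s, P (v t) := by
    rw [hinner G hGi, hGint s hs.le]
    refine tendsto_nhds_unique ((hgn.integral hs.le) w.fn) (hconv.congr fun n => ?_)
    rw [← hinner _ (hgi (gn n))]
    exact (integral_congr_ae (hae n)).symm
  have hgradi : IntegrableOn (fun t => inner ℝ (v t).grad w.grad) (Ioc 0 s) := by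
    refine Integrable.mono' (integrable_const (M * ‖w.grad‖)) ?_ ?_
    · exact ((gradL N).continuous.comp_aestronglyMeasurable hvm.aestronglyMeasurable).inner
        aestronglyMeasurable_const
    · filter_upwards [ae_restrict_mem measurableSet_Ioc] with t ht
      refine (norm_inner_le_norm _ _).trans ?_
      exact mul_le_mul_of_nonneg_right ((X.norm_grad_le _).trans (hvb t ht.1.le)) (norm_nonneg _)
  have hPvi : IntegrableOn (fun t => P (v t)) (Ioc 0 s) := by
    refine Integrable.mono' (integrable_const ((C₂ * M) ^ critExp N + funB N w + C₁ * M)) hPvm ?_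
    filter_upwards [ae_restrict_mem measurableSet_Ioc] with t ht using hPb _ (hvb t ht.1.le)
  rw [intervalIntegral.integral_of_le hs.le, intervalIntegral.integral_of_le hs.le,
    integral_add (hGi.inner_const w.fn) hgradi, hmain, ← integral_add hPvi hgradi]
  congr 1
  funext t
  rw [rhsPairing_eq hN]
  simp only [P]
  ring

end

end HardyHeat

theorem theorem3p2 (N : ℕ) (hN : 3 ≤ N) (μ : ℝ) (hμ₀ : 0 ≤ μ) (hμ : μ ≤ ((N : ℝ) - 2) ^ 2 / 8)
    (v₀ : HardyHeat.X N) (hE : HardyHeat.energy N μ v₀ < HardyHeat.depth N μ)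
    (hD : 0 < HardyHeat.funD N μ v₀) :
    ∃ v : ℝ → HardyHeat.X N,
      HardyHeat.IsWeakSolution N μ ⊤ v₀ v ∧ HardyHeat.MemLinftyX ⊤ v ∧
        ∀ s : ℝ, 0 ≤ s → v s ∈ HardyHeat.well N μ := by
  obtain ⟨v, hv, hw⟩ := HardyHeat.exists_global_solution hN hμ v₀ hE hD
  exact ⟨v, hv, hv.1, hw⟩
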